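/- Let $\kappa,\sigma,\sigma_n,\Delta t>0$ and $\theta\in\mathbb R$. Let $\{X_t\}_{t\ge 0}$ be the Ornstein--Uhlenbeck process $dX_t=\kappa(\theta-X_t)\,dt+\sigma\,dW_t$ with $X_0\sim\mathcal N(\theta,\sigma^2/(2\kappa))$ independent of the standard Brownian motion $W$. It is sampled at the times $t_i=i\,\Delta t$; the $i$-th sample is received at a time $t'_i>t_i$ as $Y_{t'_i}=X_{t_i}+N_{t'_i}$, where the $N_{t'_i}$ are i.i.d. $\mathcal N(0,\sigma_n^2)$ and independent of $\{X_t\}$. For $2\le m\le n$ and $t>t'_n$ let $v(t)=I(X_t;Y_{t'_n},\dots,Y_{t'_{n-m+1}})$ be the value of information (mutual information in nats). Put $\gamma=\sigma^2/(2\kappa\sigma_n^2)$ and $\rho=e^{-\kappa\Delta t}$. Then $v(t)$ is finite and, as $1/\gamma\to 0$, $$v(t)=\frac12\log\frac{1}{1-e^{-2\kappa(t-t_n)}}-\frac12\log\Bigl[1+\frac{1}{e^{2\kappa(t-t_n)}-1}\Bigl(\frac1\gamma-\frac{1}{(1-\rho^2)\gamma^2}\Bigr)\Bigr]+O\Bigl(\frac1{\gamma^3}\Bigr).$$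 The approximating expression does not depend on $m$. The $O$ is uniform: there are $\gamma_0>0$ and $C\ge 0$, depending only on $\kappa$, $\Delta t$ and $t-t_n$ (in particular not on $m$, $n$), such that for $\gamma\ge\gamma_0$ the error is at most $C/\gamma^3$ in absolute value. -/

import Mathlib

open MeasureTheory ProbabilityTheory Set
open scoped NNReal ENNReal

noncomputable section

/-- Mutual information `I(U; V)` in nats: the Kullback-Leibler divergence of the joint law of
`(U, V)` from the product of the marginal laws. -/
def mutualInfo {Ω α β : Type*} [MeasurableSpace Ω] [MeasurableSpace α] [MeasurableSpace β]
    (U : Ω → α) (V : Ω → β) (P : Measure Ω) : ℝ≥0∞ :=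
  InformationTheory.klDiv (P.map fun ω ↦ (U ω, V ω)) ((P.map U).prod (P.map V))

/-- `X` is the Ornstein-Uhlenbeck process driven by the Brownian motion `W`: a solution with
continuous paths of the stochastic differential equation `dX = κ (θ - X) dt + σ dW`, started from
`X 0 ∼ 𝒩(θ, σ² / (2κ))` independent of `W`. As the diffusion coefficient is constant, the
stochastic integral of the equation is `σ W t` (recall `W 0 = 0` almost surely). -/
structure IsOUProcess {Ω : Type*} [MeasurableSpace Ω] (κ θ σ : ℝ) (X W : ℝ≥0 → Ω → ℝ)
    (P : Measure Ω) : Prop where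
  brownian : IsBrownianReal W P
  hasLaw_zero : HasLaw (X 0) (gaussianReal θ (σ ^ 2 / (2 * κ)).toNNReal) P
  indep_zero : IndepFun (X 0) (fun ω t ↦ W t ω) P
  continuous : ∀ᵐ ω ∂P, Continuous fun t ↦ X t ω
  sde : ∀ᵐ ω ∂P, ∀ t : ℝ≥0,
    X t ω = X 0 ω + (∫ s in (0 : ℝ)..t, κ * (θ - X s.toNNReal ω)) + σ * W t ω

/-- The values `N (t' i)` of the noise process at the receiving times `t' i` are independent
centred Gaussian variables of variance `σn²`, and they are independent of the process `X`. -/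
structure IsChannelNoise {Ω : Type*} [MeasurableSpace Ω] (σn : ℝ) (t' : ℕ → ℝ≥0)
    (X N : ℝ≥0 → Ω → ℝ) (P : Measure Ω) : Prop where
  hasLaw : ∀ i, HasLaw (N (t' i)) (gaussianReal 0 (σn ^ 2).toNNReal) P
  iIndep : iIndepFun (fun i ↦ N (t' i)) P
  indep : IndepFun (fun ω s ↦ X s ω) (fun ω i ↦ N (t' i) ω) P

/-- The observation `X (t i) + N (t' i)` that corresponds to the sample taken at time `t i` and
received at time `t' i`. -/
def observation {Ω : Type*} (t t' : ℕ → ℝ≥0) (X N : ℝ≥0 → Ω → ℝ) (i : ℕ) : Ω → ℝ :=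
  fun ω ↦ X (t i) ω + N (t' i) ω

/-- The value of information at time `s`: the mutual information between `X s` and the `m` most
recent of the observations with indices `1, …, n`, that is, those with indices
`n - m + 1, …, n` (for `1 ≤ m ≤ n`). -/
def valueOfInformation {Ω : Type*} [MeasurableSpace Ω] (t t' : ℕ → ℝ≥0) (X N : ℝ≥0 → Ω → ℝ)
    (P : Measure Ω) (m n : ℕ) (s : ℝ≥0) : ℝ≥0∞ :=
  mutualInfo (X s) (fun ω (j : Fin m) ↦ observation t t' X N (n - m + 1 + j) ω) P

/-- Uniform sampling: `t i = i Δt`. -/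
def uniformTime (Δt : ℝ≥0) (i : ℕ) : ℝ≥0 := i * Δt

/-- The ratio `γ` of the variance `σ² / (2κ)` of the process to the variance `σn²` of the noise. -/
def snr (κ σ σn : ℝ) : ℝ := σ ^ 2 / (2 * κ) / σn ^ 2

/-- The value of information of the directly observed Ornstein-Uhlenbeck process, when the latest
sample has age `τ`. -/
def markovTerm (κ τ : ℝ) : ℝ := 1 / 2 * Real.log (1 / (1 - Real.exp (-2 * κ * τ)))

/-- The correction of second order in `1 / γ`, with `ρ = exp (-κ Δt)`. -/
def highSNRCorrection (κ τ ρ γ : ℝ) : ℝ :=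
  1 / 2 * Real.log
    (1 + 1 / (Real.exp (2 * κ * τ) - 1) * (1 / γ - 1 / ((1 - ρ ^ 2) * γ ^ 2)))

end

/-! Everything is Gaussian, so the value of information is `1/2 * log (s² / v)`, where `s² = σ² /
(2κ)` and `v` is the error variance of the best linear predictor of `X t` from the observations. Let
`q` be the error variance of `X (t n)` predicted from the older observations alone, `r = σn²` and `a
= exp (-κ τ)`. One more noisy observation reduces `q` to `q r / (q + r)`, and the Markov property
gives `v = (1 - a²) s² + a² q r / (q + r)`.

Older samples enter only through `q`. The innovation over one sampling step forces `q ≥ (1 - ρ²)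
s²`. Once an older sample exists (`m ≥ 2`), its filtered error is at most `r`, so `q ≤ (1 - ρ²) s² +
ρ² r`. In units of `s²`, with `η = 1 / γ` and `d = 1 - ρ²`, `q` lies within `η` of `d` for every
`m`, hence `q η / (q + η) = η - η² / d + O(η³)` uniformly. The logarithm is 1-Lipschitz on `[1, ∞)`,
which transfers the error to `v(t)`.

The carriers are `exists_filter_error` (the bounds on `q`), `mutualInfo_gaussian` (the information
formula) and `abs_log_sub_highSNR_le` (the expansion). The Gaussian law and covariance of `X` come
from the equation itself: pathwise, `exp (κ t) (X t - θ)` has increments that are limits of Riemann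
sums in `W`, so no stochastic integral is needed. -/

/-! ### Pathwise solution of the linear equation by Riemann-Stieltjes sums -/

section PathRiemannSum

open Filter Topology

/-- The `i`-th point of the uniform grid with `n` steps on `[s, t]`. -/
noncomputable def uniformGrid (s t : ℝ≥0) (n i : ℕ) : ℝ≥0 := s + i / n * (t - s)

lemma uniformGrid_zero (s t : ℝ≥0) (n : ℕ) : uniformGrid s t n 0 = s := by
  simp [uniformGrid]

lemma uniformGrid_self {s t : ℝ≥0} (hst : s ≤ t) {n : ℕ} (hn : n ≠ 0) :
    uniformGrid s t n n = t := by
  have : (n : ℝ≥0) ≠ 0 := by exact_mod_cast hn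
  simp [uniformGrid, div_self this, hst]

lemma uniformGrid_monotone (s t : ℝ≥0) (n : ℕ) : Monotone (uniformGrid s t n) := by
  intro i j hij
  unfold uniformGrid
  gcongr

lemma le_uniformGrid (s t : ℝ≥0) (n i : ℕ) : s ≤ uniformGrid s t n i := by
  simp [uniformGrid]

lemma uniformGrid_le {s t : ℝ≥0} (hst : s ≤ t) {n i : ℕ} (hi : i ≤ n) :
    uniformGrid s t n i ≤ t := by
  rcases eq_or_ne n 0 with rfl | hn
  · simpa [uniformGrid] using hst
  · exact (uniformGrid_monotone s t n hi).trans_eq (uniformGrid_self hst hn)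

lemma coe_uniformGrid_succ_sub {s t : ℝ≥0} (hst : s ≤ t) (n i : ℕ) :
    (uniformGrid s t n (i + 1) : ℝ) - uniformGrid s t n i = (t - s) / n := by
  simp only [uniformGrid, NNReal.coe_add, NNReal.coe_mul, NNReal.coe_div, NNReal.coe_natCast,
    NNReal.coe_sub hst]
  push_cast
  ring

/-- The left Riemann-Stieltjes sum of `exp (κ ·)` against `σ w` over `[s, t]`. -/
noncomputable def expStieltjesSum (κ σ : ℝ) (w : ℝ≥0 → ℝ) (s t : ℝ≥0) (n : ℕ) : ℝ :=
  ∑ i ∈ Finset.range n, Real.exp (κ * uniformGrid s t n i) * σ *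
    (w (uniformGrid s t n (i + 1)) - w (uniformGrid s t n i))

/-- For a solution `x` of the linear equation `dx = κ (θ - x) dt + σ dw`, the Riemann-Stieltjes
sums of `exp (κ ·)` against `σ w` converge to the increments of `exp (κ ·) (x - θ)`. -/
lemma tendsto_expStieltjesSum {κ θ σ : ℝ} {x w : ℝ≥0 → ℝ} (hx : Continuous x)
    (h : ∀ t : ℝ≥0, x t = x 0 + (∫ s in (0 : ℝ)..t, κ * (θ - x s.toNNReal)) + σ * w t)
    {s t : ℝ≥0} (hst : s ≤ t) :
    Tendsto (expStieltjesSum κ σ w s t) atTop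
      (𝓝 (Real.exp (κ * t) * (x t - θ) - Real.exp (κ * s) * (x s - θ))) := by
  set z : ℝ → ℝ := fun u ↦ x u.toNNReal - θ with hz
  have hzc : Continuous z := by
    have := hx.comp continuous_real_toNNReal
    exact this.sub continuous_const
  set f : ℝ → ℝ := fun u ↦ Real.exp (κ * u) with hf
  have hfc : Continuous f := by fun_prop
  have hfd (u : ℝ) : HasDerivAt f (κ * f u) u := by
    have := ((hasDerivAt_id u).const_mul κ).exp
    simpa [hf, mul_comm] using this
  -- `G (u, b, a)` is the integrand of the error made by the left Riemann sum on a cell `[a, b]`. It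
  -- vanishes on the diagonal, so uniform continuity makes it small on a fine grid.
  set G : ℝ × ℝ × ℝ → ℝ := fun p ↦ κ * (f p.1 * z p.2.1 - f p.2.2 * z p.1) with hG
  have hGc : Continuous G := by fun_prop
  have hxz (u : ℝ≥0) : x u - θ = z u := by simp [hz]
  have hw (a b : ℝ≥0) : σ * (w b - w a) = z b - z a + κ * ∫ u in (a : ℝ)..b, z u := by
    have h1 := h a
    have h2 := h b
    have hint (c d : ℝ) : IntervalIntegrable (fun u ↦ κ * (θ - x u.toNNReal)) volume c d := by
      have : Continuous fun u : ℝ ↦ κ * (θ - x u.toNNReal) :=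
        continuous_const.mul (continuous_const.sub (hx.comp continuous_real_toNNReal))
      exact this.intervalIntegrable _ _
    have h3 := intervalIntegral.integral_add_adjacent_intervals (hint 0 a) (hint a b)
    have h4 : ∫ u in (a : ℝ)..b, κ * (θ - x u.toNNReal) = -(κ * ∫ u in (a : ℝ)..b, z u) := by
      rw [← intervalIntegral.integral_const_mul, ← intervalIntegral.integral_neg]
      congr 1; ext u; simp only [hz]; ring
    rw [← hxz, ← hxz]
    linarith
  have hstep (a b : ℝ≥0) : f b * z b - f a * z a - f a * σ * (w b - w a)
      = ∫ u in (a : ℝ)..b, G (u, b, a) := by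
    have h1 : ∫ u in (a : ℝ)..b, κ * f u = f b - f a :=
      intervalIntegral.integral_eq_sub_of_hasDerivAt (fun u _ ↦ hfd u)
        ((continuous_const.mul hfc).intervalIntegrable _ _)
    have h2 : ∫ u in (a : ℝ)..b, G (u, b, a)
        = (∫ u in (a : ℝ)..b, κ * f u) * z b - κ * f a * ∫ u in (a : ℝ)..b, z u := by
      rw [← intervalIntegral.integral_mul_const, ← intervalIntegral.integral_const_mul,
        ← intervalIntegral.integral_sub]
      · congr 1; ext u; simp only [hG]; ring
      · exact (by fun_prop : Continuous fun u ↦ κ * f u * z b).intervalIntegrable _ _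
      · exact (by fun_prop : Continuous fun u ↦ κ * f a * z u).intervalIntegrable _ _
    rw [h2, h1, mul_assoc (f a), hw]
    ring
  rw [hxz, hxz, Metric.tendsto_atTop]
  intro ε hε
  have hst' : (s : ℝ) ≤ t := by exact_mod_cast hst
  have hcpt : IsCompact (Icc (s : ℝ) t ×ˢ Icc (s : ℝ) t ×ˢ Icc (s : ℝ) t) :=
    isCompact_Icc.prod (isCompact_Icc.prod isCompact_Icc)
  -- The errors of the cells add up to `(t - s)` times this tolerance; the `+ 1` covers the case `s
  -- = t`.
  have hε' : 0 < ε / (2 * (t - s + 1)) := by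
    have : 0 < (t : ℝ) - s + 1 := by linarith
    positivity
  obtain ⟨δ, hδ, hGδ⟩ := Metric.uniformContinuousOn_iff.1
    (hcpt.uniformContinuousOn_of_continuous hGc.continuousOn) _ hε'
  obtain ⟨n₀, hn₀⟩ := exists_nat_gt (((t : ℝ) - s) / δ)
  refine ⟨n₀ + 1, fun n hn ↦ ?_⟩
  have hnpos : 0 < n := by omega
  have hnR : (0 : ℝ) < n := by exact_mod_cast hnpos
  have hmesh : ((t : ℝ) - s) / n < δ := by
    rw [div_lt_iff₀ hnR]
    rw [div_lt_iff₀ hδ] at hn₀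
    have : (n₀ : ℝ) ≤ n := by exact_mod_cast (by omega : n₀ ≤ n)
    nlinarith
  set g := uniformGrid s t n with hg
  have htel : f t * z t - f s * z s = ∑ i ∈ Finset.range n, (f (g (i + 1)) * z (g (i + 1))
      - f (g i) * z (g i)) := by
    rw [Finset.sum_range_sub (fun i ↦ f (g i) * z (g i)), hg, uniformGrid_zero,
      uniformGrid_self hst hnpos.ne']
  have hdiff : (f t * z t - f s * z s) - expStieltjesSum κ σ w s t n
      = ∑ i ∈ Finset.range n, ∫ u in (g i : ℝ)..g (i + 1), G (u, g (i + 1), g i) := by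
    rw [htel, expStieltjesSum, ← Finset.sum_sub_distrib]
    exact Finset.sum_congr rfl fun i _ ↦ hstep _ _
  rw [dist_comm, Real.dist_eq, hdiff]
  have hterm (i : ℕ) (hi : i ∈ Finset.range n) :
      |∫ u in (g i : ℝ)..g (i + 1), G (u, g (i + 1), g i)|
        ≤ ε / (2 * (t - s + 1)) * (((t : ℝ) - s) / n) := by
    have hi' : i < n := Finset.mem_range.1 hi
    have hle : (g i : ℝ) ≤ g (i + 1) := by exact_mod_cast uniformGrid_monotone s t n i.le_succ
    have hs : (s : ℝ) ≤ g i := by exact_mod_cast le_uniformGrid s t n i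
    have ht : (g (i + 1) : ℝ) ≤ t := by exact_mod_cast uniformGrid_le hst hi'
    have hsub := coe_uniformGrid_succ_sub hst n i
    rw [← hg] at hsub
    have := intervalIntegral.norm_integral_le_of_norm_le_const (a := (g i : ℝ)) (b := g (i + 1))
      (f := fun u ↦ G (u, g (i + 1), g i)) (C := ε / (2 * (t - s + 1))) ?_
    · rwa [hsub, abs_of_nonneg (by rw [← hsub]; linarith)] at this
    intro u hu
    rw [uIoc_of_le hle] at hu
    have hzero : G ((g i : ℝ), (g i : ℝ), (g i : ℝ)) = 0 := by simp [hG]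
    have hd := hGδ (u, (g (i + 1) : ℝ), (g i : ℝ)) ?_ ((g i : ℝ), (g i : ℝ), (g i : ℝ)) ?_ ?_
    · rw [hzero, dist_zero_right] at hd
      exact hd.le
    · refine ⟨⟨?_, ?_⟩, ⟨?_, ?_⟩, ⟨?_, ?_⟩⟩ <;> simp only <;> linarith [hu.1, hu.2]
    · refine ⟨⟨?_, ?_⟩, ⟨?_, ?_⟩, ⟨?_, ?_⟩⟩ <;> simp only <;> linarith [hu.1, hu.2]
    · simp only [Prod.dist_eq, Real.dist_eq]
      rw [abs_of_nonneg (by linarith [hu.1]), abs_of_nonneg (by linarith)]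
      simp only [sub_self, abs_zero]
      refine max_lt ?_ (max_lt ?_ hδ) <;> linarith [hu.1, hu.2]
  calc _ ≤ ∑ i ∈ Finset.range n, |∫ u in (g i : ℝ)..g (i + 1), G (u, g (i + 1), g i)| :=
        Finset.abs_sum_le_sum_abs _ _
    _ ≤ ∑ i ∈ Finset.range n, ε / (2 * (t - s + 1)) * (((t : ℝ) - s) / n) :=
        Finset.sum_le_sum hterm
    _ = ε * ((t - s) / (2 * (t - s + 1))) := by
        rw [Finset.sum_const, Finset.card_range, nsmul_eq_mul]
        field_simp
    _ < ε * 1 := by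
        gcongr
        rw [div_lt_one (by linarith)]
        linarith
    _ = ε := mul_one ε

/-- The left Riemann sums of `exp (2 κ ·)` over `[s, t]` converge to the integral. -/
lemma tendsto_expRiemannSum {κ : ℝ} (hκ : κ ≠ 0) {s t : ℝ≥0} (hst : s ≤ t) :
    Tendsto (fun n ↦ ∑ i ∈ Finset.range n, Real.exp (2 * κ * uniformGrid s t n i) *
        ((uniformGrid s t n (i + 1) : ℝ) - uniformGrid s t n i)) atTop
      (𝓝 ((Real.exp (2 * κ * t) - Real.exp (2 * κ * s)) / (2 * κ))) := by
  -- The constant path `1 / (2κ)` solves the equation with rate `2κ`, mean `0` and driver `w t = t`,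
  -- since drift and driver cancel.
  have := tendsto_expStieltjesSum (κ := 2 * κ) (θ := 0) (σ := 1) (x := fun _ ↦ 1 / (2 * κ))
    (w := fun t ↦ t) continuous_const (fun t ↦ by
      simp only [intervalIntegral.integral_const, smul_eq_mul]; field_simp; ring) hst
  convert this using 2
  · simp [expStieltjesSum]
  · ring

end PathRiemannSum

/-! ### Almost sure limits of Gaussian and of independent variables -/

section GaussianLimits

open Filter Topology

variable {Ω : Type*} [MeasurableSpace Ω] {P : Measure Ω}

/-- Dominated convergence with bound `1`. Gaussianity and independence are identities between
characteristic functions, so they pass to almost sure limits by this lemma. -/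
lemma tendsto_charFun_map_of_ae_tendsto {E : Type*} [NormedAddCommGroup E] [InnerProductSpace ℝ E]
    [MeasurableSpace E] [BorelSpace E] [SecondCountableTopology E] [IsProbabilityMeasure P]
    {Y : ℕ → Ω → E} {Z : Ω → E} (hY : ∀ k, AEMeasurable (Y k) P) (hZ : AEMeasurable Z P)
    (h : ∀ᵐ ω ∂P, Tendsto (fun k ↦ Y k ω) atTop (𝓝 (Z ω))) (t : E) :
    Tendsto (fun k ↦ charFun (P.map (Y k)) t) atTop (𝓝 (charFun (P.map Z) t)) := by
  have hmap {U : Ω → E} (hU : AEMeasurable U P) :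
      charFun (P.map U) t = ∫ ω, Complex.exp (inner ℝ (U ω) t * Complex.I) ∂P := by
    rw [charFun_apply, integral_map hU]
    exact (by fun_prop : Continuous fun x : E ↦
      Complex.exp (inner ℝ x t * Complex.I)).aestronglyMeasurable
  rw [hmap hZ]
  simp_rw [hmap (hY _)]
  refine tendsto_integral_of_dominated_convergence (fun _ ↦ (1 : ℝ)) (fun k ↦ ?_)
    (integrable_const _) (fun k ↦ ?_) ?_
  · exact (by fun_prop : Continuous fun x : E ↦
      Complex.exp (inner ℝ x t * Complex.I)).comp_aestronglyMeasurable
        (hY k).aestronglyMeasurable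
  · exact ae_of_all _ fun ω ↦ (Complex.norm_exp_ofReal_mul_I _).le
  · filter_upwards [h] with ω hω
    have hc : Continuous fun x : E ↦ Complex.exp (inner ℝ x t * Complex.I) := by fun_prop
    exact (hc.tendsto _).comp hω

lemma hasLaw_gaussianReal_of_ae_tendsto [IsProbabilityMeasure P] {Y : ℕ → Ω → ℝ} {Z : Ω → ℝ}
    {m : ℝ} {v : ℕ → ℝ≥0} {v₀ : ℝ≥0} (hY : ∀ k, HasLaw (Y k) (gaussianReal m (v k)) P)
    (hv : Tendsto v atTop (𝓝 v₀))
    (h : ∀ᵐ ω ∂P, Tendsto (fun k ↦ Y k ω) atTop (𝓝 (Z ω))) :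
    HasLaw Z (gaussianReal m v₀) P := by
  have hZ : AEMeasurable Z P :=
    aemeasurable_of_tendsto_metrizable_ae' (fun k ↦ (hY k).aemeasurable) h
  refine ⟨hZ, ?_⟩
  have := Measure.isProbabilityMeasure_map hZ
  refine Measure.ext_of_charFun (funext fun t ↦ ?_)
  refine tendsto_nhds_unique
    (tendsto_charFun_map_of_ae_tendsto (fun k ↦ (hY k).aemeasurable) hZ h t) ?_
  simp_rw [(hY _).map_eq, charFun_gaussianReal]
  have hv' : Tendsto (fun k ↦ ((v k : ℝ) : ℂ)) atTop (𝓝 ((v₀ : ℝ) : ℂ)) :=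
    ((Complex.continuous_ofReal.comp NNReal.continuous_coe).tendsto _).comp hv
  exact ((tendsto_const_nhds.sub ((hv'.mul_const _).div_const _))).cexp

lemma iIndepFun_of_ae_tendsto [IsProbabilityMeasure P] {ι : Type*} [Fintype ι]
    {Y : ℕ → ι → Ω → ℝ} {Z : ι → Ω → ℝ} (hYm : ∀ k i, AEMeasurable (Y k i) P)
    (hY : ∀ k, iIndepFun (Y k) P)
    (h : ∀ i, ∀ᵐ ω ∂P, Tendsto (fun k ↦ Y k i ω) atTop (𝓝 (Z i ω))) :
    iIndepFun Z P := by
  have hZ (i : ι) : AEMeasurable (Z i) P :=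
    aemeasurable_of_tendsto_metrizable_ae' (fun k ↦ hYm k i) (h i)
  rw [iIndepFun_iff_charFun_pi hZ]
  intro t
  have hc : Continuous (WithLp.toLp 2 : (ι → ℝ) → EuclideanSpace ℝ ι) :=
    PiLp.continuous_toLp 2 _
  refine tendsto_nhds_unique (tendsto_charFun_map_of_ae_tendsto
    (Y := fun k ω ↦ WithLp.toLp 2 (Y k · ω)) (fun k ↦ ?_) ?_ ?_ t) ?_
  · exact hc.measurable.comp_aemeasurable (aemeasurable_pi_lambda _ fun i ↦ hYm k i)
  · exact hc.measurable.comp_aemeasurable (aemeasurable_pi_lambda _ hZ)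
  · filter_upwards [ae_all_iff.2 h] with ω hω
    exact (hc.tendsto _).comp (tendsto_pi_nhds.2 hω)
  · simp_rw [fun k ↦ (iIndepFun_iff_charFun_pi (hYm k)).1 (hY k) t]
    exact tendsto_finsetProd _ fun i _ ↦
      tendsto_charFun_map_of_ae_tendsto (fun k ↦ hYm k i) (hZ i) (h i) _

lemma indepFun_pi_of_ae_tendsto [IsProbabilityMeasure P] {ι : Type*} [Fintype ι]
    {U : Ω → ℝ} {Y : ℕ → ι → Ω → ℝ} {Z : ι → Ω → ℝ} (hU : AEMeasurable U P)
    (hYm : ∀ k i, AEMeasurable (Y k i) P)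
    (hY : ∀ k, IndepFun U (fun ω i ↦ Y k i ω) P)
    (h : ∀ i, ∀ᵐ ω ∂P, Tendsto (fun k ↦ Y k i ω) atTop (𝓝 (Z i ω))) :
    IndepFun U (fun ω i ↦ Z i ω) P := by
  have hZ (i : ι) : AEMeasurable (Z i) P :=
    aemeasurable_of_tendsto_metrizable_ae' (fun k ↦ hYm k i) (h i)
  have hc : Continuous (WithLp.toLp 2 : (ι → ℝ) → EuclideanSpace ℝ ι) :=
    PiLp.continuous_toLp 2 _
  have hZ' : AEMeasurable (fun ω ↦ WithLp.toLp 2 (Z · ω) : Ω → EuclideanSpace ℝ ι) P :=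
    hc.measurable.comp_aemeasurable (aemeasurable_pi_lambda _ hZ)
  have hY' (k : ℕ) : AEMeasurable (fun ω ↦ WithLp.toLp 2 (Y k · ω) : Ω → EuclideanSpace ℝ ι) P :=
    hc.measurable.comp_aemeasurable (aemeasurable_pi_lambda _ fun i ↦ hYm k i)
  have hlim : ∀ᵐ ω ∂P, Tendsto (fun k ↦ (WithLp.toLp 2 (Y k · ω) : EuclideanSpace ℝ ι)) atTop
      (𝓝 (WithLp.toLp 2 (Z · ω))) := by
    filter_upwards [ae_all_iff.2 h] with ω hω
    exact (hc.tendsto _).comp (tendsto_pi_nhds.2 hω)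
  suffices hs : IndepFun U (fun ω ↦ WithLp.toLp 2 (Z · ω) : Ω → EuclideanSpace ℝ ι) P from
    hs.comp measurable_id (PiLp.continuous_ofLp 2 _).measurable
  rw [indepFun_iff_charFun_prod hU hZ']
  intro t
  have hp : Continuous (WithLp.toLp 2 : ℝ × EuclideanSpace ℝ ι → _) :=
    WithLp.prod_continuous_toLp 2 _ _
  refine tendsto_nhds_unique (tendsto_charFun_map_of_ae_tendsto
    (Y := fun k ω ↦ WithLp.toLp 2 (U ω, (WithLp.toLp 2 (Y k · ω) : EuclideanSpace ℝ ι)))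
    (fun k ↦ ?_) ?_ ?_ t) ?_
  · exact hp.measurable.comp_aemeasurable (hU.prodMk (hY' k))
  · exact hp.measurable.comp_aemeasurable (hU.prodMk hZ')
  · filter_upwards [hlim] with ω hω
    exact (hp.tendsto _).comp (tendsto_const_nhds.prodMk_nhds hω)
  · have hY'' (k : ℕ) :
        IndepFun U (fun ω ↦ WithLp.toLp 2 (Y k · ω) : Ω → EuclideanSpace ℝ ι) P :=
      (hY k).comp measurable_id hc.measurable
    simp_rw [fun k ↦ (indepFun_iff_charFun_prod hU (hY' k)).1 (hY'' k) t]
    exact tendsto_const_nhds.mul (tendsto_charFun_map_of_ae_tendsto hY' hZ' hlim _)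

end GaussianLimits

/-! ### Constructions of Gaussian processes -/

section GaussianProcesses

variable {Ω : Type*} [MeasurableSpace Ω] {P : Measure Ω}

/-- The general tool for joint Gaussianity below: finite linear combinations, with index sets and
coefficients varying with `s`, are continuous linear images of finite marginals. -/
lemma ProbabilityTheory.IsGaussianProcess.sum_mul {T S ι : Type*} {X : T → Ω → ℝ}
    (hX : IsGaussianProcess X P) (J : S → Finset ι) (c : S → ι → ℝ) (f : S → ι → T) :
    IsGaussianProcess (fun s ω ↦ ∑ j ∈ J s, c s j * X (f s j) ω) P := by
  classical
  refine hX.of_isGaussianProcess fun s ↦ ⟨(J s).image (f s),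
    ∑ j ∈ (J s).attach, c s j • .proj ⟨f s j, Finset.mem_image_of_mem _ j.2⟩, fun ω ↦ ?_⟩
  rw [← Finset.sum_attach]
  simp

lemma ProbabilityTheory.IsGaussianProcess.hasGaussianLaw_pi {S : Type*} [Fintype S]
    {X : S → Ω → ℝ} (hX : IsGaussianProcess X P) : HasGaussianLaw (fun ω s ↦ X s ω) P :=
  let L : (↥(Finset.univ : Finset S) → ℝ) →L[ℝ] S → ℝ := .pi fun s ↦ .proj ⟨s, Finset.mem_univ s⟩
  ((hX.hasGaussianLaw Finset.univ).map_fun L).congr (ae_of_all _ fun _ ↦ rfl)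

lemma ProbabilityTheory.IndepFun.isGaussianProcess_sumElim {S T : Type*} {X : S → Ω → ℝ}
    {Y : T → Ω → ℝ} (hX : IsGaussianProcess X P) (hY : IsGaussianProcess Y P)
    (h : IndepFun (fun ω s ↦ X s ω) (fun ω t ↦ Y t ω) P) :
    IsGaussianProcess (Sum.elim X Y) P where
  hasGaussianLaw I := by
    have hind : IndepFun (fun ω ↦ I.toLeft.restrict (X · ω)) (fun ω ↦ I.toRight.restrict (Y · ω)) P :=
      h.comp (φ := I.toLeft.restrict) (ψ := I.toRight.restrict) (by fun_prop) (by fun_prop)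
    have hg := hind.hasGaussianLaw (hX.hasGaussianLaw I.toLeft) (hY.hasGaussianLaw I.toRight)
    let L : (I.toLeft → ℝ) × (I.toRight → ℝ) →L[ℝ] I → ℝ := .pi fun
      | ⟨.inl s, hs⟩ => (.proj ⟨s, Finset.mem_toLeft.2 hs⟩ : (I.toLeft → ℝ) →L[ℝ] ℝ).comp
          (.fst ℝ _ _)
      | ⟨.inr t, ht⟩ => (.proj ⟨t, Finset.mem_toRight.2 ht⟩ : (I.toRight → ℝ) →L[ℝ] ℝ).comp
          (.snd ℝ _ _)
    convert! hg.map L using 2 with ω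
    ext ⟨i, hi⟩
    cases i <;> rfl

lemma ProbabilityTheory.iIndepFun.isGaussianProcess {T : Type*} {X : T → Ω → ℝ}
    (hX : ∀ t, HasGaussianLaw (X t) P) (h : iIndepFun X P) : IsGaussianProcess X P where
  hasGaussianLaw I := (h.precomp (g := ((↑) : I → T)) Subtype.val_injective).hasGaussianLaw
    fun i ↦ hX i

/-- The increments `W b - W a` of a Gaussian process form a Gaussian process. -/
lemma ProbabilityTheory.IsGaussianProcess.increments {T : Type*} {X : T → Ω → ℝ}
    (hX : IsGaussianProcess X P) :
    IsGaussianProcess (fun (p : T × T) ω ↦ X p.2 ω - X p.1 ω) P := by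
  have := hX.sum_mul (S := T × T) (ι := Bool) (fun _ ↦ Finset.univ)
    (fun _ b ↦ bif b then 1 else -1) (fun p b ↦ bif b then p.2 else p.1)
  refine this.congr fun p ↦ ae_of_all _ fun ω ↦ ?_
  simp [sub_eq_add_neg]

end GaussianProcesses

/-! ### Gaussian law and covariance of the Ornstein-Uhlenbeck process -/

section OrnsteinUhlenbeck

open Filter Topology

namespace IsOUProcess

variable {Ω : Type*} {κ θ : ℝ} {X : ℝ≥0 → Ω → ℝ}

/-- The martingale part `exp (κ t) (X t - θ) - (X 0 - θ)` of an Ornstein-Uhlenbeck process. -/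
noncomputable def martingalePart (κ θ : ℝ) (X : ℝ≥0 → Ω → ℝ) (t : ℝ≥0) (ω : Ω) : ℝ :=
  Real.exp (κ * t) * (X t ω - θ) - (X 0 ω - θ)

lemma martingalePart_zero (ω : Ω) : martingalePart κ θ X 0 ω = 0 := by simp [martingalePart]

/-- The Ornstein-Uhlenbeck process in terms of its initial value and its martingale part. -/
lemma sub_eq_exp_mul (t : ℝ≥0) (ω : Ω) :
    X t ω - θ = Real.exp (-κ * t) * (X 0 ω - θ) + Real.exp (-κ * t) * martingalePart κ θ X t ω := by
  have : Real.exp (-κ * t) * Real.exp (κ * t) = 1 := by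
    rw [← Real.exp_add]; simp
  rw [martingalePart]
  linear_combination (-(X t ω - θ)) * this

end IsOUProcess

variable {Ω : Type*} [MeasurableSpace Ω] {P : Measure Ω} {W : ℝ≥0 → Ω → ℝ}

lemma ProbabilityTheory.IsPreBrownianReal.covariance_increments (hW : IsPreBrownianReal W P)
    {a b c d : ℝ≥0} (hab : a ≤ b) (hbc : b ≤ c) (hcd : c ≤ d) :
    cov[fun ω ↦ W b ω - W a ω, fun ω ↦ W d ω - W c ω; P] = 0 := by
  have hL (t : ℝ≥0) : MemLp (W t) 2 P := (hW.isGaussianProcess.hasGaussianLaw_eval t).memLp_two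
  have := hW.isGaussianProcess.isProbabilityMeasure
  rw [covariance_fun_sub_fun_sub (hL _) (hL _) (hL _) (hL _)]
  simp only [hW.covariance_fun_eval]
  rw [min_eq_left (hbc.trans hcd), min_eq_left hbc, min_eq_left (hab.trans (hbc.trans hcd)),
    min_eq_left (hab.trans hbc)]
  ring

/-- The variance of `expStieltjesSum κ σ (W · ω) s t n` for a Brownian motion `W`. -/
noncomputable def expStieltjesSumVariance (κ σ : ℝ) (s t : ℝ≥0) (n : ℕ) : ℝ :=
  ∑ i ∈ Finset.range n, (Real.exp (κ * uniformGrid s t n i) * σ) ^ 2 *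
    ((uniformGrid s t n (i + 1) : ℝ) - uniformGrid s t n i)

lemma tendsto_expStieltjesSumVariance {κ : ℝ} (hκ : κ ≠ 0) (σ : ℝ) {s t : ℝ≥0} (hst : s ≤ t) :
    Tendsto (expStieltjesSumVariance κ σ s t) atTop
      (𝓝 (σ ^ 2 / (2 * κ) * (Real.exp (2 * κ * t) - Real.exp (2 * κ * s)))) := by
  convert (tendsto_expRiemannSum hκ hst).const_mul (σ ^ 2) using 2 with n
  · rw [expStieltjesSumVariance, Finset.mul_sum]
    refine Finset.sum_congr rfl fun i _ ↦ ?_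
    rw [mul_pow, ← Real.exp_nat_mul]
    push_cast
    ring_nf
  · ring

lemma ProbabilityTheory.IsPreBrownianReal.isGaussianProcess_expStieltjesSum
    (hW : IsPreBrownianReal W P) (κ σ : ℝ) (n : ℕ) :
    IsGaussianProcess (fun (p : ℝ≥0 × ℝ≥0) ω ↦ expStieltjesSum κ σ (W · ω) p.1 p.2 n) P := by
  have := hW.isGaussianProcess.increments.sum_mul (S := ℝ≥0 × ℝ≥0) (fun _ ↦ Finset.range n)
    (fun p i ↦ Real.exp (κ * uniformGrid p.1 p.2 n i) * σ)
    (fun p i ↦ (uniformGrid p.1 p.2 n i, uniformGrid p.1 p.2 n (i + 1)))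
  simpa only [expStieltjesSum] using this

lemma ProbabilityTheory.IsPreBrownianReal.hasLaw_expStieltjesSum (hW : IsPreBrownianReal W P)
    (κ σ : ℝ) (s t : ℝ≥0) (n : ℕ) :
    HasLaw (fun ω ↦ expStieltjesSum κ σ (W · ω) s t n)
      (gaussianReal 0 (expStieltjesSumVariance κ σ s t n).toNNReal) P := by
  have hg := (hW.isGaussianProcess_expStieltjesSum κ σ n).hasGaussianLaw_eval (s, t)
  have hprob := hg.isProbabilityMeasure
  refine ⟨hg.aemeasurable, ?_⟩
  set u := uniformGrid s t n
  have hL (i : ℕ) : MemLp (fun ω ↦ Real.exp (κ * u i) * σ * (W (u (i + 1)) ω - W (u i) ω)) 2 P :=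
    ((hW.isGaussianProcess.increments.hasGaussianLaw_eval (u i, u (i + 1))).memLp_two).const_mul _
  rw [hg.map_eq_gaussianReal]
  congr
  · simp only [expStieltjesSum]
    rw [integral_finsetSum _ fun i _ ↦ (hL i).integrable (by norm_num)]
    refine Finset.sum_eq_zero fun i _ ↦ ?_
    rw [integral_const_mul, integral_sub (hW.integrable_eval _) (hW.integrable_eval _),
      hW.integral_eval, hW.integral_eval]
    simp
  · simp only [expStieltjesSum]
    rw [variance_fun_sum' (fun i _ ↦ hL i), expStieltjesSumVariance]
    refine Finset.sum_congr rfl fun i hi ↦ ?_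
    -- Increments over distinct cells are uncorrelated, so only the diagonal of the double sum
    -- survives.
    rw [Finset.sum_eq_single_of_mem i hi]
    · rw [covariance_self (hL i).aemeasurable, variance_const_mul]
      congr 1
      have := (hW.hasLaw_sub (u (i + 1)) (u i)).variance_eq
      rw [variance_id_gaussianReal] at this
      refine this.trans ?_
      rw [coe_nndist, Real.dist_eq, abs_of_nonneg]
      · rfl
      · exact sub_nonneg.2 (NNReal.coe_le_coe.2 (uniformGrid_monotone s t n i.le_succ))
    · intro j _ hji
      rw [covariance_const_mul_left, covariance_const_mul_right]
      have : cov[fun ω ↦ W (u (i + 1)) ω - W (u i) ω, fun ω ↦ W (u (j + 1)) ω - W (u j) ω; P] = 0 := by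
        rcases lt_or_gt_of_ne hji with h | h
        · rw [covariance_comm]
          exact hW.covariance_increments (uniformGrid_monotone s t n j.le_succ)
            (uniformGrid_monotone s t n h) (uniformGrid_monotone s t n i.le_succ)
        · exact hW.covariance_increments (uniformGrid_monotone s t n i.le_succ)
            (uniformGrid_monotone s t n h) (uniformGrid_monotone s t n j.le_succ)
      rw [this]
      simp

lemma ProbabilityTheory.IsPreBrownianReal.covariance_expStieltjesSum (hW : IsPreBrownianReal W P)
    (κ σ : ℝ) {a b c d : ℝ≥0} (hab : a ≤ b) (hbc : b ≤ c) (n : ℕ) :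
    cov[fun ω ↦ expStieltjesSum κ σ (W · ω) a b n, fun ω ↦ expStieltjesSum κ σ (W · ω) c d n; P]
      = 0 := by
  have := hW.isGaussianProcess.isProbabilityMeasure
  have hL (r s : ℝ≥0) (i : ℕ) : MemLp (fun ω ↦ Real.exp (κ * uniformGrid r s n i) * σ *
      (W (uniformGrid r s n (i + 1)) ω - W (uniformGrid r s n i) ω)) 2 P :=
    ((hW.isGaussianProcess.increments.hasGaussianLaw_eval
      (uniformGrid r s n i, uniformGrid r s n (i + 1))).memLp_two).const_mul _
  simp only [expStieltjesSum]
  rw [covariance_fun_sum_fun_sum' (fun i _ ↦ hL a b i) (fun j _ ↦ hL c d j)]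
  refine Finset.sum_eq_zero fun i hi ↦ Finset.sum_eq_zero fun j _ ↦ ?_
  rw [covariance_const_mul_left, covariance_const_mul_right, hW.covariance_increments
    (uniformGrid_monotone _ _ _ i.le_succ) _ (uniformGrid_monotone _ _ _ j.le_succ)]
  · simp
  · exact (uniformGrid_le hab (Finset.mem_range.1 hi)).trans (hbc.trans (le_uniformGrid _ _ _ _))

/-- The sums use Brownian increments over non-overlapping intervals, hence are uncorrelated; joint
Gaussianity turns this into independence. -/
lemma ProbabilityTheory.IsPreBrownianReal.iIndepFun_expStieltjesSum (hW : IsPreBrownianReal W P)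
    (κ σ : ℝ) {m : ℕ} {t : Fin (m + 1) → ℝ≥0} (ht : Monotone t) (n : ℕ) :
    iIndepFun (fun (i : Fin m) ω ↦ expStieltjesSum κ σ (W · ω) (t i.castSucc) (t i.succ) n) P := by
  have hg := ((hW.isGaussianProcess_expStieltjesSum κ σ n).comp_right
    fun i : Fin m ↦ (t i.castSucc, t i.succ)).hasGaussianLaw_pi
  refine HasGaussianLaw.iIndepFun_of_covariance_eq_zero hg fun i j hij ↦ ?_
  rcases lt_or_gt_of_ne hij with h | h
  · exact hW.covariance_expStieltjesSum κ σ (ht (Fin.castSucc_le_succ i))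
      (ht (Fin.le_castSucc_iff.2 (Fin.succ_lt_succ_iff.2 h))) n
  · rw [covariance_comm]
    exact hW.covariance_expStieltjesSum κ σ (ht (Fin.castSucc_le_succ j))
      (ht (Fin.le_castSucc_iff.2 (Fin.succ_lt_succ_iff.2 h))) n

namespace IsOUProcess

variable {κ θ σ : ℝ} {X : ℝ≥0 → Ω → ℝ}

lemma isProbabilityMeasure (hX : IsOUProcess κ θ σ X W P) : IsProbabilityMeasure P :=
  hX.brownian.isGaussianProcess.isProbabilityMeasure

lemma ae_tendsto_expStieltjesSum (hX : IsOUProcess κ θ σ X W P) {s t : ℝ≥0} (hst : s ≤ t) :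
    ∀ᵐ ω ∂P, Tendsto (fun n ↦ expStieltjesSum κ σ (W · ω) s t n) atTop
      (𝓝 (martingalePart κ θ X t ω - martingalePart κ θ X s ω)) := by
  filter_upwards [hX.continuous, hX.sde] with ω hc hs
  convert tendsto_expStieltjesSum hc hs hst using 2
  simp [martingalePart]

lemma ae_tendsto_martingalePart (hX : IsOUProcess κ θ σ X W P) (t : ℝ≥0) :
    ∀ᵐ ω ∂P, Tendsto (fun n ↦ expStieltjesSum κ σ (W · ω) 0 t n) atTop
      (𝓝 (martingalePart κ θ X t ω)) := by
  filter_upwards [hX.ae_tendsto_expStieltjesSum (zero_le (a := t))] with ω h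
  rwa [martingalePart_zero, sub_zero] at h

lemma hasLaw_martingalePart (hX : IsOUProcess κ θ σ X W P) (hκ : κ ≠ 0) (t : ℝ≥0) :
    HasLaw (martingalePart κ θ X t)
      (gaussianReal 0 (σ ^ 2 / (2 * κ) * (Real.exp (2 * κ * t) - 1)).toNNReal) P := by
  have := hX.isProbabilityMeasure
  refine hasLaw_gaussianReal_of_ae_tendsto
    (fun n ↦ hX.brownian.hasLaw_expStieltjesSum κ σ 0 t n) ?_ (hX.ae_tendsto_martingalePart t)
  have := tendsto_expStieltjesSumVariance hκ σ (zero_le (a := t))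
  simp only [NNReal.coe_zero, mul_zero, Real.exp_zero] at this
  exact (continuous_real_toNNReal.tendsto _).comp this

lemma hasIndepIncrements_martingalePart (hX : IsOUProcess κ θ σ X W P) :
    HasIndepIncrements (martingalePart κ θ X) P := by
  have := hX.isProbabilityMeasure
  intro m t ht
  exact iIndepFun_of_ae_tendsto
    (fun n i ↦ (hX.brownian.hasLaw_expStieltjesSum κ σ _ _ n).aemeasurable)
    (fun n ↦ hX.brownian.iIndepFun_expStieltjesSum κ σ ht n)
    fun i ↦ hX.ae_tendsto_expStieltjesSum (ht (Fin.castSucc_le_succ i))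

lemma isGaussianProcess_martingalePart (hX : IsOUProcess κ θ σ X W P) (hκ : κ ≠ 0) :
    IsGaussianProcess (martingalePart κ θ X) P :=
  hX.hasIndepIncrements_martingalePart.isGaussianProcess
    (fun t ↦ (hX.hasLaw_martingalePart hκ t).hasGaussianLaw)
    (ae_of_all _ fun ω ↦ martingalePart_zero ω)

lemma indepFun_zero_martingalePart (hX : IsOUProcess κ θ σ X W P) (hκ : κ ≠ 0) :
    IndepFun (X 0) (fun ω t ↦ martingalePart κ θ X t ω) P := by
  have := hX.isProbabilityMeasure
  have hm (t : ℝ≥0) := (hX.hasLaw_martingalePart hκ t).aemeasurable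
  -- Independence from a process is tested on finitely many times, where the limit lemma applies.
  refine IndepFun.indepFun_process₀ hX.hasLaw_zero.aemeasurable hm fun I ↦ ?_
  refine indepFun_pi_of_ae_tendsto (Y := fun n (i : I) ω ↦ expStieltjesSum κ σ (W · ω) 0 i n)
    hX.hasLaw_zero.aemeasurable
    (fun n i ↦ (hX.brownian.hasLaw_expStieltjesSum κ σ _ _ n).aemeasurable) (fun n ↦ ?_)
    fun i ↦ hX.ae_tendsto_martingalePart i
  refine hX.indep_zero.comp (φ := id) (ψ := fun w (i : I) ↦ expStieltjesSum κ σ w 0 i n)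
    measurable_id (measurable_pi_lambda _ fun i ↦ ?_)
  unfold expStieltjesSum
  fun_prop

/-- Independence of the increment over `[s, t]` from the value at `s` leaves only the variance at
`s`. -/
lemma covariance_martingalePart (hX : IsOUProcess κ θ σ X W P) (hκ : 0 < κ) {s t : ℝ≥0}
    (hst : s ≤ t) :
    cov[martingalePart κ θ X s, martingalePart κ θ X t; P]
      = σ ^ 2 / (2 * κ) * (Real.exp (2 * κ * s) - 1) := by
  have := hX.isProbabilityMeasure
  have hL (t : ℝ≥0) : MemLp (martingalePart κ θ X t) 2 P :=
    (hX.hasLaw_martingalePart hκ.ne' t).hasGaussianLaw.memLp_two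
  have hind := hX.hasIndepIncrements_martingalePart.indepFun_eval_sub (zero_le (a := s)) hst
    (ae_of_all _ fun ω ↦ martingalePart_zero ω)
  have hsum : martingalePart κ θ X t
      = martingalePart κ θ X s + (martingalePart κ θ X t - martingalePart κ θ X s) := by simp
  rw [hsum, covariance_add_right (hL s) (hL s) ((hL t).sub (hL s)),
    hind.covariance_eq_zero (hL s) ((hL t).sub (hL s)), covariance_self (hL s).aemeasurable,
    (hX.hasLaw_martingalePart hκ.ne' s).variance_eq, variance_id_gaussianReal, add_zero,
    Real.coe_toNNReal]
  have : 1 ≤ Real.exp (2 * κ * s) := Real.one_le_exp (by positivity)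
  have : 0 ≤ Real.exp (2 * κ * s) - 1 := by linarith
  positivity

lemma hasLaw_zero_sub (hX : IsOUProcess κ θ σ X W P) :
    HasLaw (fun ω ↦ X 0 ω - θ) (gaussianReal 0 (σ ^ 2 / (2 * κ)).toNNReal) P := by
  simpa using gaussianReal_sub_const hX.hasLaw_zero θ

lemma isGaussianProcess_sub (hX : IsOUProcess κ θ σ X W P) (hκ : κ ≠ 0) :
    IsGaussianProcess (fun t ω ↦ X t ω - θ) P := by
  have hprob := hX.isProbabilityMeasure
  have h0 : IsGaussianProcess (fun (_ : Unit) ω ↦ X 0 ω - θ) P :=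
    iIndepFun.isGaussianProcess (fun _ ↦ hX.hasLaw_zero_sub.hasGaussianLaw)
      iIndepFun.of_subsingleton
  have hind : IndepFun (fun ω (_ : Unit) ↦ X 0 ω - θ) (fun ω t ↦ martingalePart κ θ X t ω) P :=
    (hX.indepFun_zero_martingalePart hκ).comp (φ := fun x _ ↦ x - θ) (by fun_prop) measurable_id
  have := (IndepFun.isGaussianProcess_sumElim h0 (hX.isGaussianProcess_martingalePart hκ)
    hind).sum_mul (S := ℝ≥0) (ι := Bool) (fun _ ↦ Finset.univ)
    (fun t _ ↦ Real.exp (-κ * t)) (fun t b ↦ bif b then .inl () else .inr t)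
  refine this.congr fun t ↦ ae_of_all _ fun ω ↦ ?_
  change _ = X t ω - θ
  rw [sub_eq_exp_mul (κ := κ) t ω]
  simp

/-- The initial variance `σ² / (2κ)` cancels the `-1` in the covariance of the martingale part; this
is stationarity. -/
lemma covariance_sub (hX : IsOUProcess κ θ σ X W P) (hκ : 0 < κ) {s t : ℝ≥0} (hst : s ≤ t) :
    cov[fun ω ↦ X s ω - θ, fun ω ↦ X t ω - θ; P]
      = σ ^ 2 / (2 * κ) * Real.exp (-κ * (t - s)) := by
  have := hX.isProbabilityMeasure
  have hL (t : ℝ≥0) : MemLp (martingalePart κ θ X t) 2 P :=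
    (hX.hasLaw_martingalePart hκ.ne' t).hasGaussianLaw.memLp_two
  have hL0 : MemLp (fun ω ↦ X 0 ω - θ) 2 P := hX.hasLaw_zero_sub.hasGaussianLaw.memLp_two
  have hind (t : ℝ≥0) : IndepFun (fun ω ↦ X 0 ω - θ) (martingalePart κ θ X t) P :=
    (hX.indepFun_zero_martingalePart hκ.ne').comp (φ := fun x ↦ x - θ)
      (ψ := fun f : ℝ≥0 → ℝ ↦ f t) (by fun_prop) (by fun_prop)
  have hc (t : ℝ≥0) : cov[fun ω ↦ X 0 ω - θ, martingalePart κ θ X t; P] = 0 :=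
    (hind t).covariance_eq_zero hL0 (hL t)
  have hv : cov[fun ω ↦ X 0 ω - θ, fun ω ↦ X 0 ω - θ; P] = σ ^ 2 / (2 * κ) := by
    rw [covariance_self hL0.aemeasurable, hX.hasLaw_zero_sub.variance_eq, variance_id_gaussianReal,
      Real.coe_toNNReal]
    positivity
  have hrep (t : ℝ≥0) : (fun ω ↦ X t ω - θ) = (fun ω ↦ Real.exp (-κ * t) * (X 0 ω - θ))
      + fun ω ↦ Real.exp (-κ * t) * martingalePart κ θ X t ω := funext (sub_eq_exp_mul t)
  rw [hrep s, hrep t, covariance_add_left (hL0.const_mul _) ((hL s).const_mul _)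
      ((hL0.const_mul _).add ((hL t).const_mul _)),
    covariance_add_right (hL0.const_mul _) (hL0.const_mul _) ((hL t).const_mul _),
    covariance_add_right ((hL s).const_mul _) (hL0.const_mul _) ((hL t).const_mul _)]
  simp only [covariance_const_mul_left, covariance_const_mul_right]
  rw [hv, hc, covariance_comm, hc, hX.covariance_martingalePart hκ hst]
  have h1 : Real.exp (-κ * (t - s))
      = Real.exp (-κ * s) * (Real.exp (-κ * t) * Real.exp (2 * κ * s)) := by
    rw [← Real.exp_add, ← Real.exp_add]; ring_nf
  rw [h1]
  ring

end IsOUProcess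

end OrnsteinUhlenbeck

/-! ### Mutual information of a Gaussian signal with independent estimation error -/

section GaussianChannel

variable {Ω : Type*} [MeasurableSpace Ω] {P : Measure Ω}

lemma log_gaussianPDFReal (m : ℝ) {v : ℝ≥0} (hv : v ≠ 0) (x : ℝ) :
    Real.log (gaussianPDFReal m v x)
      = -(1 / 2 * Real.log (2 * Real.pi * v)) - (x - m) ^ 2 / (2 * v) := by
  have hv' : (0 : ℝ) < v := by positivity
  have h2 : 0 < 2 * Real.pi * v := by positivity
  rw [gaussianPDFReal, Real.log_mul (inv_ne_zero (Real.sqrt_ne_zero'.2 h2)) (Real.exp_ne_zero _),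
    Real.log_exp, Real.log_inv, Real.log_sqrt h2.le]
  ring

variable {β : Type*} [MeasurableSpace β] {U e : Ω → ℝ} {V : Ω → β} {L : β → ℝ}
  {mu me : ℝ} {vu ve : ℝ≥0}

/-- The joint law of `U = L V + e` and `V`, where `e` is Gaussian and independent of `V`, has an
explicit density with respect to the product of the marginals when `U` is Gaussian. -/
lemma map_prodMk_eq_withDensity_gaussianPDF (hL : Measurable L) (hV : AEMeasurable V P)
    [IsProbabilityMeasure P] (hvu : vu ≠ 0) (hve : ve ≠ 0)
    (hU : HasLaw U (gaussianReal mu vu) P) (he : HasLaw e (gaussianReal me ve) P)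
    (hUe : ∀ᵐ ω ∂P, U ω = L (V ω) + e ω) (hind : IndepFun V e P) :
    P.map (fun ω ↦ (U ω, V ω)) = ((P.map U).prod (P.map V)).withDensity
      fun p ↦ gaussianPDF me ve (p.1 - L p.2) / gaussianPDF mu vu p.1 := by
  have := Measure.isProbabilityMeasure_map hV
  have hpe := measurable_gaussianPDF me ve
  have hpu := measurable_gaussianPDF mu vu
  have hd : Measurable fun p : ℝ × β ↦
      gaussianPDF me ve (p.1 - L p.2) / gaussianPDF mu vu p.1 := by fun_prop
  have hjoint : P.map (fun ω ↦ (U ω, V ω))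
      = ((P.map V).prod (gaussianReal me ve)).map fun q ↦ (L q.1 + q.2, q.1) := by
    rw [← he.map_eq, ← (indepFun_iff_map_prod_eq_prod_map_map hV he.aemeasurable).1 hind,
      AEMeasurable.map_map_of_aemeasurable (by fun_prop) (hV.prodMk he.aemeasurable)]
    refine Measure.map_congr ?_
    filter_upwards [hUe] with ω hω
    simp [hω]
  ext s hs
  have hs1 : Measurable (s.indicator (fun _ ↦ (1 : ℝ≥0∞))) := measurable_const.indicator hs
  rw [withDensity_apply _ hs, ← lintegral_indicator hs, lintegral_prod_symm _
    (hd.indicator hs).aemeasurable, hjoint, ← lintegral_indicator_one hs,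
    lintegral_map (by exact hs1) (by fun_prop), lintegral_prod _ (by
      exact (hs1.comp (by fun_prop : Measurable fun q : β × ℝ ↦ (L q.1 + q.2, q.1))).aemeasurable)]
  -- For fixed `v`, translation by `L v` makes `u = L v + x` the variable; the signal density is
  -- positive and finite, so it cancels.
  refine lintegral_congr fun v ↦ ?_
  rw [hU.map_eq, gaussianReal_of_var_ne_zero _ hve, gaussianReal_of_var_ne_zero _ hvu,
    lintegral_withDensity_eq_lintegral_mul _ hpe (by
      exact hs1.comp (by fun_prop : Measurable fun x : ℝ ↦ (L v + x, v))),
    lintegral_withDensity_eq_lintegral_mul _ hpu (by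
      exact (hd.indicator hs).comp (by fun_prop : Measurable fun x : ℝ ↦ (x, v))),
    ← lintegral_sub_right_eq_self _ (L v)]
  refine lintegral_congr fun u ↦ ?_
  simp only [Pi.mul_apply, add_sub_cancel]
  by_cases hus : (u, v) ∈ s
  · simp only [hus, indicator_of_mem, Pi.one_apply, mul_one]
    rw [ENNReal.mul_div_cancel (gaussianPDF_pos _ hvu _).ne' gaussianPDF_ne_top]
  · simp [hus]

/-- The mutual information of jointly Gaussian variables in terms of the variance `vu` of the
signal and the variance `ve` of the estimation error. -/
lemma mutualInfo_gaussian (hL : Measurable L) (hV : AEMeasurable V P)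
    [IsProbabilityMeasure P] (hvu : vu ≠ 0) (hve : ve ≠ 0)
    (hU : HasLaw U (gaussianReal mu vu) P) (he : HasLaw e (gaussianReal me ve) P)
    (hUe : ∀ᵐ ω ∂P, U ω = L (V ω) + e ω) (hind : IndepFun V e P) :
    mutualInfo U V P ≠ ∞ ∧ (mutualInfo U V P).toReal = 1 / 2 * Real.log (vu / ve) := by
  have := Measure.isProbabilityMeasure_map hV
  have := Measure.isProbabilityMeasure_map hU.aemeasurable
  have hUV : AEMeasurable (fun ω ↦ (U ω, V ω)) P := hU.aemeasurable.prodMk hV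
  have := Measure.isProbabilityMeasure_map hUV
  set μ := P.map fun ω ↦ (U ω, V ω) with hμ
  set ν := (P.map U).prod (P.map V) with hν
  have hpe := measurable_gaussianPDF me ve
  have hpu := measurable_gaussianPDF mu vu
  set d : ℝ × β → ℝ≥0∞ := fun p ↦ gaussianPDF me ve (p.1 - L p.2) / gaussianPDF mu vu p.1 with hd
  have hdm : Measurable d := by fun_prop
  have hdens : μ = ν.withDensity d :=
    map_prodMk_eq_withDensity_gaussianPDF hL hV hvu hve hU he hUe hind
  have hac : μ ≪ ν := hdens ▸ withDensity_absolutelyContinuous _ _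
  have hllr : llr μ ν =ᵐ[μ] fun p ↦ Real.log (d p).toReal := by
    have : μ.rnDeriv ν =ᵐ[ν] d := by
      rw [hdens]; exact Measure.rnDeriv_withDensity _ hdm
    filter_upwards [hac.ae_le this] with p hp
    rw [llr, hp]
  -- The two normalised squares both have mean `1/2`, so only the logarithm of the variance ratio
  -- survives integration.
  have hcomp : (fun ω ↦ llr μ ν (U ω, V ω)) =ᵐ[P] fun ω ↦
      1 / 2 * Real.log (vu / ve) + ((U ω - mu) ^ 2 / (2 * vu) - (e ω - me) ^ 2 / (2 * ve)) := by
    filter_upwards [ae_of_ae_map hUV hllr, hUe] with ω h1 h2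
    have h3 : U ω - L (V ω) = e ω := by rw [h2]; ring
    have hve' : (0 : ℝ) < ve := by positivity
    have hvu' : (0 : ℝ) < vu := by positivity
    rw [h1, hd]
    simp only [h3, ENNReal.toReal_div, toReal_gaussianPDF]
    rw [Real.log_div (gaussianPDFReal_pos _ _ _ hve).ne' (gaussianPDFReal_pos _ _ _ hvu).ne',
      log_gaussianPDFReal _ hve, log_gaussianPDFReal _ hvu, Real.log_mul (by positivity) hve'.ne',
      Real.log_mul (by positivity) hvu'.ne', Real.log_div hvu'.ne' hve'.ne']
    ring
  have hsq {Z : Ω → ℝ} {m : ℝ} {v : ℝ≥0} (hZ : HasLaw Z (gaussianReal m v) P) :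
      Integrable (fun ω ↦ (Z ω - m) ^ 2) P ∧ ∫ ω, (Z ω - m) ^ 2 ∂P = v := by
    refine ⟨(hZ.hasGaussianLaw.memLp_two.sub (memLp_const m)).integrable_sq, ?_⟩
    have h1 := hZ.variance_eq
    rw [variance_eq_integral hZ.aemeasurable, hZ.integral_eq, variance_id_gaussianReal] at h1
    simpa using h1
  have hdiff : Integrable (fun ω ↦ (U ω - mu) ^ 2 / (2 * vu) - (e ω - me) ^ 2 / (2 * ve)) P :=
    ((hsq hU).1.div_const _).sub ((hsq he).1.div_const _)
  have hmeas : AEStronglyMeasurable (llr μ ν) μ := (measurable_llr μ ν).aestronglyMeasurable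
  have hint : Integrable (llr μ ν) μ :=
    (integrable_map_measure hmeas hUV).2 (((integrable_const _).add hdiff).congr hcomp.symm)
  refine ⟨InformationTheory.klDiv_ne_top hac hint, ?_⟩
  rw [mutualInfo, InformationTheory.toReal_klDiv_of_measure_eq hac (by simp),
    integral_map hUV hmeas, integral_congr_ae hcomp, integral_add (integrable_const _) hdiff,
    integral_sub ((hsq hU).1.div_const _) ((hsq he).1.div_const _), integral_div, integral_div,
    (hsq hU).2, (hsq he).2]
  have hve' : (ve : ℝ) ≠ 0 := by exact_mod_cast hve
  have hvu' : (vu : ℝ) ≠ 0 := by exact_mod_cast hvu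
  simp only [integral_const, probReal_univ, one_smul]
  field_simp
  ring

end GaussianChannel

/-! ### Linear filtering for a symmetric bilinear form -/

section LinearFiltering

variable {M : Type*} [AddCommGroup M] [Module ℝ M] {B : LinearMap.BilinForm ℝ M}

lemma LinearMap.BilinForm.apply_eq_zero_of_mem_span {S : Set M} {e p : M}
    (h : ∀ s ∈ S, B e s = 0) (hp : p ∈ Submodule.span ℝ S) : B e p = 0 := by
  have : Submodule.span ℝ S ≤ LinearMap.ker (B e) := Submodule.span_le.2 h
  exact this hp

/-- Prediction step of linear filtering: if `p` is the orthogonal projection of `x` on the span of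
`S` and `u - a x` is orthogonal to `S` and `x`, then `a p` is the projection of `u`. -/
lemma prediction_step (hB : B.IsSymm) {S : Set M} {x u p : M} {a : ℝ}
    (hp : p ∈ Submodule.span ℝ S) (hxp : ∀ s ∈ S, B (x - p) s = 0)
    (hu : ∀ s ∈ S, B (u - a • x) s = 0) (hux : B (u - a • x) x = 0) :
    (∀ s ∈ S, B (u - a • p) s = 0) ∧
      B (u - a • p) (u - a • p) = B u u - a ^ 2 * B x x + a ^ 2 * B (x - p) (x - p) := by
  have hdecomp : u - a • p = (u - a • x) + a • (x - p) := by module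
  refine ⟨fun s hs ↦ ?_, ?_⟩
  · rw [hdecomp, map_add, LinearMap.add_apply, map_smul, LinearMap.smul_apply, hu s hs, hxp s hs]
    simp
  · have h1 : B (u - a • x) p = 0 := B.apply_eq_zero_of_mem_span hu hp
    have h2 : B (x - p) (u - a • x) = 0 := by
      rw [hB.eq, map_sub, hux, h1, sub_zero]
    have h3 : B (u - a • x) (x - p) = 0 := by rw [map_sub, hux, h1, sub_zero]
    have h4 : B (u - a • x) (u - a • x) = B u u - a ^ 2 * B x x := by
      have h5 : B u x = a * B x x := by
        simpa [sub_eq_zero] using hux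
      have h6 : B x u = a * B x x := by rw [hB.eq, h5]
      simp only [map_sub, LinearMap.sub_apply, map_smul, LinearMap.smul_apply, smul_eq_mul]
      rw [h5, h6]
      ring
    rw [hdecomp]
    simp only [map_add, LinearMap.add_apply, map_smul, LinearMap.smul_apply, smul_eq_mul]
    rw [h2, h3, h4]
    ring

/-- Update step of linear filtering: the effect of one further noisy observation `x + z` of `x`. -/
lemma update_step (hB : B.IsSymm) {S : Set M} {x z p : M} {q r : ℝ}
    (hp : p ∈ Submodule.span ℝ S) (hxp : ∀ s ∈ S, B (x - p) s = 0) (hq : B (x - p) (x - p) = q)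
    (hzS : ∀ s ∈ S, B z s = 0) (hzx : B z x = 0) (hzz : B z z = r) (hqr : q + r ≠ 0) :
    ∃ p' ∈ Submodule.span ℝ (insert (x + z) S),
      (∀ s ∈ insert (x + z) S, B (x - p') s = 0) ∧ B (x - p') (x - p') = q * r / (q + r) := by
  have hpz : B z p = 0 := B.apply_eq_zero_of_mem_span hzS hp
  have hee : B (x - p) p = 0 := B.apply_eq_zero_of_mem_span hxp hp
  have hze : B z (x - p) = 0 := by rw [map_sub, hzx, hpz, sub_zero]
  have hez : B (x - p) z = 0 := by rw [hB.eq, hze]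
  have hxe : B (x - p) x = q := by rw [← hq, map_sub (B (x - p)), hee, sub_zero]
  -- The Kalman gain: the multiple of the residual `x + z - p` for which the new error is orthogonal
  -- to `x + z`.
  set g : ℝ := q / (q + r) with hg
  have hx' : x - (p + g • (x + z - p)) = (1 - g) • (x - p) - g • z := by module
  have horth : ∀ s ∈ insert (x + z) S, B (x - (p + g • (x + z - p))) s = 0 := by
    intro s hs
    rw [hx', map_sub, LinearMap.sub_apply, map_smul, map_smul, LinearMap.smul_apply,
      LinearMap.smul_apply, smul_eq_mul, smul_eq_mul]
    rcases hs with rfl | hs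
    · rw [map_add, map_add, hxe, hez, hzx, hzz, hg]
      field_simp
      ring
    · rw [hxp s hs, hzS s hs]
      simp
  refine ⟨p + g • (x + z - p), ?_, horth, ?_⟩
  · have h1 : p ∈ Submodule.span ℝ (insert (x + z) S) :=
      Submodule.span_mono (subset_insert _ _) hp
    have h2 : x + z ∈ Submodule.span ℝ (insert (x + z) S) :=
      Submodule.subset_span (mem_insert _ _)
    exact add_mem h1 (Submodule.smul_mem _ _ (sub_mem h2 h1))
  · rw [hx']
    simp only [map_sub (B _), map_sub B, LinearMap.sub_apply, map_smul, LinearMap.smul_apply,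
      smul_eq_mul]
    simp only [map_sub, LinearMap.sub_apply] at hq hze hez
    have h1 : B x z - B p z = 0 := hez
    rw [hzz]
    have h2 : B x x - B p x - (B x p - B p p) = q := by linarith
    have : ((1 - g) * ((1 - g) * q) + g * (g * r)) = q * r / (q + r) := by
      rw [hg]; field_simp; ring
    rw [← this]
    linear_combination (1 - g) ^ 2 * h2 - g * (1 - g) * h1 - g * (1 - g) * hze

/-- The error variance of the linear filter for an autoregressive sequence `x` of variance `s` and
correlation `ρ`, observed with white noise `z` of variance `r`. -/
lemma exists_filter_error (hB : B.IsSymm) {x z : ℕ → M} {s ρ r : ℝ} (hs : 0 < s) (hr : 0 < r)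
    (hρ : ρ ^ 2 < 1) (hx : ∀ i j, i ≤ j → B (x i) (x j) = s * ρ ^ (j - i))
    (hzx : ∀ i j, B (z i) (x j) = 0) (hz : ∀ i, B (z i) (z i) = r)
    (hzz : ∀ i j, i ≠ j → B (z i) (z j) = 0) (k : ℕ) :
    ∃ q, (1 - ρ ^ 2) * s ≤ q ∧ (1 ≤ k → q ≤ (1 - ρ ^ 2) * s + ρ ^ 2 * r) ∧
      ∃ p ∈ Submodule.span ℝ ((fun j ↦ x j + z j) '' Iio (k + 1)),
        (∀ y ∈ (fun j ↦ x j + z j) '' Iio (k + 1), B (x k - p) y = 0) ∧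
        B (x k - p) (x k - p) = q * r / (q + r) := by
  induction k with
  | zero =>
    have hS : (fun j ↦ x j + z j) '' Iio (0 + 1) = insert (x 0 + z 0) ∅ := by
      ext y; simp
    -- Without older observations the prediction variance is the full `s`; the upper bound is
    -- claimed only for `1 ≤ k`.
    refine ⟨s, by nlinarith [sq_nonneg ρ], by simp, ?_⟩
    rw [hS]
    refine update_step hB (p := 0) (by simp) (by simp) ?_ (by simp) (hzx 0 0) (hz 0) (by positivity)
    rw [sub_zero, hx 0 0 le_rfl]
    simp
  | succ k ih =>
    obtain ⟨q, hq, -, p, hp, horth, hvar⟩ := ih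
    have hq0 : 0 < q := lt_of_lt_of_le (mul_pos (by linarith) hs) hq
    have hS : (fun j ↦ x j + z j) '' Iio (k + 1 + 1)
        = insert (x (k + 1) + z (k + 1)) ((fun j ↦ x j + z j) '' Iio (k + 1)) := by
      have : Iio (k + 1 + 1) = insert (k + 1) (Iio (k + 1)) := by ext j; simp
      rw [this, image_insert_eq]
    have hxs (i j : ℕ) : B (x i) (z j) = 0 := by rw [hB.eq, hzx]
    -- The geometric covariance makes the innovation orthogonal to the past.
    have hξ (j : ℕ) (hj : j ≤ k) : B (x (k + 1) - ρ • x k) (x j) = 0 := by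
      rw [hB.eq]
      rw [map_sub, map_smul, hx j _ (by omega), hx j k hj, Nat.succ_sub hj, pow_succ, smul_eq_mul]
      ring
    have hpred := prediction_step hB (u := x (k + 1)) (a := ρ) hp horth ?_ (hξ k le_rfl)
    · rw [hx _ _ le_rfl, hx _ _ le_rfl, hvar] at hpred
      simp only [Nat.sub_self, pow_zero, mul_one] at hpred
      refine ⟨s - ρ ^ 2 * s + ρ ^ 2 * (q * r / (q + r)), ?_, fun _ ↦ ?_, ?_⟩
      · have : 0 ≤ ρ ^ 2 * (q * r / (q + r)) := by positivity
        linarith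
      -- The filtered error never exceeds the noise variance, whatever the number of older samples;
      -- hence uniformity in `m`.
      · have : q * r / (q + r) ≤ r := by
          rw [div_le_iff₀ (by positivity)]
          nlinarith
        nlinarith [sq_nonneg ρ]
      · rw [hS]
        refine update_step hB (Submodule.smul_mem _ ρ hp) hpred.1 hpred.2 ?_ (hzx _ _) (hz _) ?_
        · rintro _ ⟨j, hj, rfl⟩
          have hj' : j < k + 1 := hj
          simp [hzx, hzz (k + 1) j (by omega)]
        · have : 0 ≤ ρ ^ 2 * (q * r / (q + r)) := by positivity
          nlinarith
    · rintro _ ⟨j, hj, rfl⟩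
      have hj' : j < k + 1 := hj
      have h1 := hξ j (by omega)
      have h2 : B (x (k + 1) - ρ • x k) (z j) = 0 := by
        simp [hxs]
      simp only [map_add, h1, h2, add_zero]

end LinearFiltering

/-! ### Covariance as a bilinear form -/

section CovarianceForm

variable {Ω : Type*} [MeasurableSpace Ω]

/-- The real random variables with a finite second moment. -/
def squareIntegrable (P : Measure Ω) : Submodule ℝ (Ω → ℝ) where
  carrier := {f | MemLp f 2 P}
  add_mem' hf hg := MemLp.add hf hg
  zero_mem' := MemLp.zero
  smul_mem' c _ hf := MemLp.const_smul hf c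

/-- The covariance as a bilinear form. -/
noncomputable def covarianceForm (P : Measure Ω) [IsFiniteMeasure P] :
    LinearMap.BilinForm ℝ (squareIntegrable P) :=
  LinearMap.mk₂ ℝ (fun f g ↦ cov[(f : Ω → ℝ), (g : Ω → ℝ); P])
    (fun f g h ↦ covariance_add_left f.2 g.2 h.2)
    (fun c _ _ ↦ covariance_smul_left c)
    (fun f g h ↦ covariance_add_right f.2 g.2 h.2)
    (fun c _ _ ↦ covariance_smul_right c)

lemma isSymm_covarianceForm (P : Measure Ω) [IsFiniteMeasure P] : (covarianceForm P).IsSymm :=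
  ⟨fun _ _ ↦ covariance_comm _ _⟩

end CovarianceForm

/-! ### Expansion for large `γ` -/

section HighSNR

/-- The value of information for error variance `q r / (q + r)` of the filtered sample (relative to
the variance of the process, with `r = 1 / γ`) agrees with its expansion up to `O(1 / γ³)`. -/
lemma abs_log_sub_highSNR_le {κ τ ρ γ q : ℝ} (hκ : 0 < κ) (hτ : 0 < τ) (hρ : ρ ^ 2 < 1)
    (hγ : 1 / (1 - ρ ^ 2) ≤ γ) (hq : 1 - ρ ^ 2 ≤ q) (hq' : q ≤ 1 - ρ ^ 2 + ρ ^ 2 * (1 / γ)) :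
    |1 / 2 * Real.log (1 / (1 - Real.exp (-κ * τ) ^ 2
          + Real.exp (-κ * τ) ^ 2 * (q * (1 / γ) / (q + 1 / γ))))
        - (markovTerm κ τ - highSNRCorrection κ τ ρ γ)|
      ≤ 1 / (Real.exp (2 * κ * τ) - 1) / (1 - ρ ^ 2) ^ 2 / γ ^ 3 := by
  set d := 1 - ρ ^ 2 with hd
  have hd0 : 0 < d := by linarith
  have hγ0 : 0 < γ := lt_of_lt_of_le (by positivity) hγ
  set η := 1 / γ with hη
  have hη0 : 0 < η := by positivity
  have hηd : η ≤ d := by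
    rw [hη, div_le_iff₀ hγ0]
    rw [div_le_iff₀ hd0] at hγ
    linarith
  have hq0 : 0 < q := by linarith
  set E := Real.exp (2 * κ * τ) with hE
  have hE1 : 1 < E := Real.one_lt_exp_iff.2 (by positivity)
  have hE0 : 0 < E := by linarith
  have ha : Real.exp (-κ * τ) ^ 2 = E⁻¹ := by
    rw [← Real.exp_nat_mul, hE, ← Real.exp_neg]
    push_cast
    ring_nf
  have ha' : Real.exp (-2 * κ * τ) = E⁻¹ := by
    rw [hE, ← Real.exp_neg]
    ring_nf
  set c := 1 / (E - 1) with hc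
  have hc0 : 0 < c := by
    have : 0 < E - 1 := by linarith
    positivity
  set u := q * η / (q + η) with hu
  have hu0 : 0 ≤ u := by positivity
  set w := η - η ^ 2 / d with hw
  have hw0 : 0 ≤ w := by
    rw [hw, sub_nonneg, div_le_iff₀ hd0]
    nlinarith
  have hcorr : highSNRCorrection κ τ ρ γ = 1 / 2 * Real.log (1 + c * w) := by
    rw [highSNRCorrection]
    congr 3
    rw [← hE, ← hc, ← hd, hw, hη]
    congr 1
    field_simp
  have h1a : 0 < 1 - E⁻¹ := by
    have : E⁻¹ < 1 := inv_lt_one_of_one_lt₀ hE1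
    linarith
  -- Factoring out `1 - E⁻¹` separates the Markov term from the correction.
  have hsplit : 1 - E⁻¹ + E⁻¹ * u = (1 - E⁻¹) * (1 + c * u) := by
    have : E - 1 ≠ 0 := by linarith
    rw [hc]
    field_simp
  have hA : 1 ≤ 1 + c * u := by nlinarith [mul_nonneg hc0.le hu0]
  have hB : 1 ≤ 1 + c * w := by nlinarith [mul_nonneg hc0.le hw0]
  rw [hcorr, markovTerm, ha, ha', hsplit, one_div (_ * _), Real.log_inv,
    Real.log_mul h1a.ne' (by positivity), one_div (1 - E⁻¹), Real.log_inv]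
  have hlog {a b : ℝ} (ha : 1 ≤ a) (hb : 1 ≤ b) : Real.log a - Real.log b ≤ |a - b| := by
    have hb0 : 0 < b := by linarith
    have ha0 : 0 < a := by linarith
    rw [← Real.log_div ha0.ne' hb0.ne']
    have h1 := Real.log_le_sub_one_of_pos (div_pos ha0 hb0)
    have h2 : a / b - 1 = (a - b) / b := by field_simp
    have h3 : (a - b) / b ≤ |a - b| / b := by gcongr; exact le_abs_self _
    have h4 : |a - b| / b ≤ |a - b| := div_le_self (abs_nonneg _) hb
    linarith
  have hlog' : |Real.log (1 + c * w) - Real.log (1 + c * u)| ≤ c * |w - u| := by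
    have h0 : |(1 + c * w) - (1 + c * u)| = c * |w - u| := by
      rw [show (1 + c * w) - (1 + c * u) = c * (w - u) by ring, abs_mul, abs_of_pos hc0]
    have h1 := hlog hB hA
    have h2 := hlog hA hB
    rw [abs_sub_comm (1 + c * u)] at h2
    rw [h0] at h1 h2
    exact abs_le.2 ⟨by linarith, h1⟩
  -- The numerator of `w - u` is `η²` times `q + η - d`, which lies in `[0, 2η]` by the bounds on
  -- `q`; this yields the third order.
  have hwu : |w - u| ≤ 2 * η ^ 3 / d ^ 2 := by
    have hqη : 0 < q + η := by positivity
    have h1 : w - u = -(η ^ 2 * (q + η - d) / (d * (q + η))) := by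
      rw [hw, hu]
      field_simp
      ring
    have h2 : 0 ≤ q + η - d := by linarith
    have hρ0 := sq_nonneg ρ
    have h3 : q + η - d ≤ 2 * η := by nlinarith
    rw [h1, abs_neg, abs_of_nonneg (by positivity)]
    calc η ^ 2 * (q + η - d) / (d * (q + η)) ≤ η ^ 2 * (2 * η) / (d * d) := by
          gcongr
          linarith
      _ = 2 * η ^ 3 / d ^ 2 := by ring
  calc _ = 1 / 2 * |Real.log (1 + c * w) - Real.log (1 + c * u)| := by
        rw [← abs_of_pos (show (0 : ℝ) < 1 / 2 by norm_num), ← abs_mul,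
          abs_of_pos (show (0 : ℝ) < 1 / 2 by norm_num)]
        congr 1
        ring
    _ ≤ 1 / 2 * (c * (2 * η ^ 3 / d ^ 2)) := by gcongr; exact hlog'.trans (by gcongr)
    _ = c / d ^ 2 / γ ^ 3 := by rw [hη]; field_simp

end HighSNR

/-! ### The value of information as a filtering error -/

section ValueOfInformation

variable {Ω : Type*} [MeasurableSpace Ω] {P : Measure Ω} {κ θ σ σn : ℝ} {X W N : ℝ≥0 → Ω → ℝ}
  {t' : ℕ → ℝ≥0}

namespace IsChannelNoise

lemma isGaussianProcess (hN : IsChannelNoise σn t' X N P) :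
    IsGaussianProcess (fun i ↦ N (t' i)) P :=
  hN.iIndep.isGaussianProcess fun i ↦ (hN.hasLaw i).hasGaussianLaw

lemma covariance_eq_zero (hN : IsChannelNoise σn t' X N P) {i j : ℕ} (hij : i ≠ j) :
    cov[N (t' i), N (t' j); P] = 0 :=
  (hN.iIndep.indepFun hij).covariance_eq_zero (hN.hasLaw i).hasGaussianLaw.memLp_two
    (hN.hasLaw j).hasGaussianLaw.memLp_two

lemma covariance_self (hN : IsChannelNoise σn t' X N P) (i : ℕ) :
    cov[N (t' i), N (t' i); P] = σn ^ 2 := by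
  rw [ProbabilityTheory.covariance_self (hN.hasLaw i).aemeasurable, (hN.hasLaw i).variance_eq,
    variance_id_gaussianReal, Real.coe_toNNReal _ (sq_nonneg _)]

end IsChannelNoise

/-- The sampled process and the channel noise are jointly Gaussian. -/
lemma IsOUProcess.isGaussianProcess_sumElim (hX : IsOUProcess κ θ σ X W P) (hκ : κ ≠ 0)
    (hN : IsChannelNoise σn t' X N P) :
    IsGaussianProcess (Sum.elim (fun s ω ↦ X s ω - θ) fun i ↦ N (t' i)) P :=
  IndepFun.isGaussianProcess_sumElim (hX.isGaussianProcess_sub hκ) hN.isGaussianProcess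
    (hN.indep.comp (φ := fun f s ↦ f s - θ) (by fun_prop) measurable_id)

lemma IsOUProcess.covariance_noise (hX : IsOUProcess κ θ σ X W P) (hκ : κ ≠ 0)
    (hN : IsChannelNoise σn t' X N P) (s : ℝ≥0) (i : ℕ) :
    cov[fun ω ↦ X s ω - θ, N (t' i); P] = 0 := by
  have hind : IndepFun (fun ω ↦ X s ω - θ) (N (t' i)) P :=
    hN.indep.comp (φ := fun f : ℝ≥0 → ℝ ↦ f s - θ) (ψ := fun f : ℕ → ℝ ↦ f i) (by fun_prop)
      (by fun_prop)
  exact hind.covariance_eq_zero ((hX.isGaussianProcess_sub hκ).hasGaussianLaw_eval s).memLp_two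
    (hN.hasLaw i).hasGaussianLaw.memLp_two

/-- If the best linear predictor `∑ j, b j * (X (τ j) - θ + N (t' (i j)))` of `X s - θ` has error
variance `v`, then the mutual information of `X s` and the observations is
`1 / 2 * log (σ² / (2κ) / v)`. -/
lemma IsOUProcess.mutualInfo_eq (hX : IsOUProcess κ θ σ X W P) (hκ : 0 < κ) (hσ : 0 < σ)
    (hN : IsChannelNoise σn t' X N P) {m : ℕ} (τ : Fin m → ℝ≥0) (i : Fin m → ℕ) (s : ℝ≥0)
    (b : Fin m → ℝ) {v : ℝ} (hv : 0 < v)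
    (hcov : ∀ k, cov[fun ω ↦ X s ω - θ - ∑ j, b j * (X (τ j) ω - θ + N (t' (i j)) ω),
      fun ω ↦ X (τ k) ω - θ + N (t' (i k)) ω; P] = 0)
    (hvar : Var[fun ω ↦ X s ω - θ - ∑ j, b j * (X (τ j) ω - θ + N (t' (i j)) ω); P] = v) :
    mutualInfo (X s) (fun ω j ↦ X (τ j) ω + N (t' (i j)) ω) P ≠ ∞ ∧
    (mutualInfo (X s) (fun ω j ↦ X (τ j) ω + N (t' (i j)) ω) P).toReal
      = 1 / 2 * Real.log (σ ^ 2 / (2 * κ) / v) := by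
  have hprob := hX.isProbabilityMeasure
  have hs2 : 0 < σ ^ 2 / (2 * κ) := by positivity
  set Y : Fin m → Ω → ℝ := fun j ω ↦ X (τ j) ω - θ + N (t' (i j)) ω with hY
  set e : Ω → ℝ := fun ω ↦ X s ω - θ - ∑ j, b j * Y j ω with he
  -- The index `none` stands for the signal and `some j` for the `j`-th centred observation.
  have hH : IsGaussianProcess (fun (o : Option (Fin m)) ω ↦ o.elim (X s ω - θ) (Y · ω)) P := by
    have := (hX.isGaussianProcess_sumElim hκ.ne' hN).sum_mul (S := Option (Fin m)) (ι := Bool)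
      (fun o ↦ o.elim {true} fun _ ↦ Finset.univ) (fun _ _ ↦ 1)
      (fun o c ↦ o.elim (.inl s) fun j ↦ bif c then .inl (τ j) else .inr (i j))
    refine this.congr fun o ↦ ae_of_all _ fun ω ↦ ?_
    cases o <;> simp [hY]
  have hYe : IsGaussianProcess (Sum.elim Y fun (_ : Unit) ↦ e) P := by
    have := hH.sum_mul (S := Fin m ⊕ Unit) (ι := Option (Fin m)) (fun _ ↦ Finset.univ)
      (fun c o ↦ c.elim (fun j ↦ if o = some j then 1 else 0) fun _ ↦ o.elim 1 fun j ↦ -b j)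
      (fun _ o ↦ o)
    refine this.congr fun c ↦ ae_of_all _ fun ω ↦ ?_
    rcases c with j | _
    · simp
    · simp [he, sub_eq_add_neg]
  have hYm (j : Fin m) : AEMeasurable (Y j) P := hYe.aemeasurable (.inl j)
  -- Joint Gaussianity upgrades orthogonality of the prediction error to independence from all
  -- observations.
  have hind : IndepFun (fun ω j ↦ Y j ω) (fun ω (_ : Unit) ↦ e ω) P :=
    hYe.indepFun_of_covariance_eq_zero hYm (fun _ ↦ hYe.aemeasurable (.inr ())) fun j _ ↦ by
      rw [covariance_comm]; exact hcov j
  have hV : (fun ω j ↦ X (τ j) ω + N (t' (i j)) ω) = fun ω j ↦ Y j ω + θ := by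
    ext ω j; simp only [hY]; ring
  have hVm : AEMeasurable (fun ω j ↦ Y j ω + θ) P :=
    aemeasurable_pi_lambda _ fun j ↦ (hYm j).add_const θ
  have hVe : IndepFun (fun ω j ↦ Y j ω + θ) e P :=
    hind.comp (φ := fun y j ↦ y j + θ) (ψ := fun f : Unit → ℝ ↦ f ()) (by fun_prop) (by fun_prop)
  have heg : HasGaussianLaw e P := hYe.hasGaussianLaw_eval (.inr ())
  have heL : HasLaw e (gaussianReal P[e] v.toNNReal) P :=
    ⟨heg.aemeasurable, by rw [heg.map_eq_gaussianReal, hvar]⟩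
  have hUg : HasGaussianLaw (fun ω ↦ X s ω - θ) P :=
    (hX.isGaussianProcess_sub hκ.ne').hasGaussianLaw_eval s
  have hUv : Var[fun ω ↦ X s ω - θ; P] = σ ^ 2 / (2 * κ) := by
    rw [← covariance_self hUg.aemeasurable, hX.covariance_sub hκ le_rfl]
    simp
  have hUL : HasLaw (X s) (gaussianReal (P[fun ω ↦ X s ω - θ] + θ) (σ ^ 2 / (2 * κ)).toNNReal) P := by
    have : HasLaw (fun ω ↦ X s ω - θ)
        (gaussianReal P[fun ω ↦ X s ω - θ] (σ ^ 2 / (2 * κ)).toNNReal) P :=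
      ⟨hUg.aemeasurable, by rw [hUg.map_eq_gaussianReal, hUv]⟩
    simpa using gaussianReal_add_const this θ
  have := mutualInfo_gaussian (L := fun y ↦ θ + ∑ j, b j * (y j - θ)) (by fun_prop) hVm
    (Real.toNNReal_pos.2 hs2).ne' (Real.toNNReal_pos.2 hv).ne' hUL heL
    (ae_of_all _ fun ω ↦ by simp [he]) hVe
  rw [hV]
  rwa [Real.coe_toNNReal _ hs2.le, Real.coe_toNNReal _ hv.le] at this

lemma uniformTime_le_uniformTime (Δt : ℝ≥0) {i j : ℕ} (hij : i ≤ j) :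
    uniformTime Δt i ≤ uniformTime Δt j := by
  unfold uniformTime
  gcongr

lemma exp_neg_mul_sq_lt_one (hκ : 0 < κ) {Δt : ℝ≥0} (hΔt : 0 < Δt) :
    Real.exp (-κ * Δt) ^ 2 < 1 := by
  have h : 0 < κ * Δt := by positivity
  exact pow_lt_one₀ (Real.exp_pos _).le (Real.exp_lt_one_iff.2 (by linarith)) (by norm_num)

/-- The value of information of the `m` most recent noisy observations is determined by the
error variance of the linear filter. -/
lemma IsOUProcess.exists_valueOfInformation_eq (hX : IsOUProcess κ θ σ X W P) (hκ : 0 < κ)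
    (hσ : 0 < σ) (hσn : 0 < σn) (hN : IsChannelNoise σn t' X N P) {Δt : ℝ≥0} (hΔt : 0 < Δt)
    {m n : ℕ} (hm : 1 ≤ m) (hmn : m ≤ n) {t : ℝ≥0} (ht : uniformTime Δt n ≤ t) :
    let s2 := σ ^ 2 / (2 * κ)
    let ρ := Real.exp (-κ * Δt)
    let a := Real.exp (-κ * (t - uniformTime Δt n))
    ∃ q, (1 - ρ ^ 2) * s2 ≤ q ∧ (2 ≤ m → q ≤ (1 - ρ ^ 2) * s2 + ρ ^ 2 * σn ^ 2) ∧
      valueOfInformation (uniformTime Δt) t' X N P m n t ≠ ∞ ∧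
      (valueOfInformation (uniformTime Δt) t' X N P m n t).toReal
        = 1 / 2 * Real.log (s2 / (s2 - a ^ 2 * s2 + a ^ 2 * (q * σn ^ 2 / (q + σn ^ 2)))) := by
  intro s2 ρ a
  have hprob := hX.isProbabilityMeasure
  have hs2 : 0 < s2 := by positivity
  have hr : 0 < σn ^ 2 := by positivity
  have hρ : ρ ^ 2 < 1 := exp_neg_mul_sq_lt_one hκ hΔt
  have ha : a ^ 2 ≤ 1 := by
    have : a ≤ 1 := Real.exp_le_one_iff.2 (by
      have h1 : (uniformTime Δt n : ℝ) ≤ t := by exact_mod_cast ht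
      nlinarith)
    exact pow_le_one₀ (Real.exp_pos _).le this
  have hLX (s : ℝ≥0) : MemLp (fun ω ↦ X s ω - θ) 2 P :=
    ((hX.isGaussianProcess_sub hκ.ne').hasGaussianLaw_eval s).memLp_two
  have hLN (i : ℕ) : MemLp (N (t' i)) 2 P := (hN.hasLaw i).hasGaussianLaw.memLp_two
  obtain ⟨k, rfl⟩ : ∃ k, m = k + 1 := ⟨m - 1, by omega⟩
  -- The oldest sample used; as `m ≤ n`, the subtraction does not truncate and sample `n` has
  -- relative index `k = m - 1`. By stationarity the filter may start there.
  set i₀ := n - (k + 1) + 1 with hi₀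
  have hi₀n : i₀ + k = n := by omega
  let x (j : ℕ) : squareIntegrable P := ⟨fun ω ↦ X (uniformTime Δt (i₀ + j)) ω - θ, hLX _⟩
  let z (j : ℕ) : squareIntegrable P := ⟨N (t' (i₀ + j)), hLN _⟩
  let u : squareIntegrable P := ⟨fun ω ↦ X t ω - θ, hLX _⟩
  set B := covarianceForm P
  have hB : B.IsSymm := isSymm_covarianceForm P
  have hxx (i j : ℕ) (hij : i ≤ j) : B (x i) (x j) = s2 * ρ ^ (j - i) := by
    change cov[fun ω ↦ X _ ω - θ, fun ω ↦ X _ ω - θ; P] = _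
    rw [hX.covariance_sub hκ (uniformTime_le_uniformTime _ (by omega)), ← Real.exp_nat_mul]
    congr 2
    simp only [uniformTime, NNReal.coe_mul, NNReal.coe_natCast]
    push_cast [Nat.cast_sub hij]
    ring
  have hxu (j : ℕ) (hj : j ≤ k) : B (x j) u = a * (s2 * ρ ^ (k - j)) := by
    change cov[fun ω ↦ X _ ω - θ, fun ω ↦ X _ ω - θ; P] = _
    rw [hX.covariance_sub hκ ((uniformTime_le_uniformTime _ (by omega)).trans ht),
      ← Real.exp_nat_mul, mul_left_comm, ← Real.exp_add, ← hi₀n]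
    congr 2
    simp only [uniformTime, NNReal.coe_mul, NNReal.coe_natCast]
    push_cast [Nat.cast_sub hj]
    ring
  have huu : B u u = s2 := by
    change cov[fun ω ↦ X _ ω - θ, fun ω ↦ X _ ω - θ; P] = _
    rw [hX.covariance_sub hκ le_rfl]
    simp [s2]
  have hxz (i j : ℕ) : B (x i) (z j) = 0 := hX.covariance_noise hκ.ne' hN _ _
  have huz (j : ℕ) : B u (z j) = 0 := hX.covariance_noise hκ.ne' hN _ _
  have hzx (i j : ℕ) : B (z i) (x j) = 0 := by rw [hB.eq, hxz]
  obtain ⟨q, hq, hq', p, hp, horth, hvar⟩ := exists_filter_error hB hs2 hr hρ hxx hzx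
    (fun i ↦ hN.covariance_self _) (fun i j hij ↦ hN.covariance_eq_zero (by omega)) k
  have hq0 : 0 < q := lt_of_lt_of_le (mul_pos (by linarith) hs2) hq
  have hux (j : ℕ) (hj : j ≤ k) : B (u - a • x k) (x j) = 0 := by
    rw [hB.eq, map_sub, map_smul, hxu j hj, hxx j k hj, smul_eq_mul, sub_self]
  have hpred := prediction_step hB (u := u) (a := a) hp horth (by
    rintro _ ⟨j, hj, rfl⟩
    have hj' : j < k + 1 := hj
    have h1 := hux j (by omega)
    have h2 : B (u - a • x k) (z j) = 0 := by simp [hxz, huz]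
    simp only [map_add, h1, h2, add_zero]) (hux k le_rfl)
  rw [huu, hxx k k le_rfl, hvar, Nat.sub_self, pow_zero, mul_one] at hpred
  have hrange : (fun j ↦ x j + z j) '' Iio (k + 1) = range fun j : Fin (k + 1) ↦ x j + z j := by
    ext y
    constructor
    · rintro ⟨j, hj, rfl⟩
      exact ⟨⟨j, hj⟩, rfl⟩
    · rintro ⟨j, rfl⟩
      exact ⟨j, j.2, rfl⟩
  rw [hrange] at hp hpred
  obtain ⟨c, hc⟩ := (Submodule.mem_span_range_iff_exists_fun ℝ).1 hp
  have hup : ((u - a • p : squareIntegrable P) : Ω → ℝ) = fun ω ↦ X t ω - θ - ∑ j : Fin (k + 1),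
      a * c j * (X (uniformTime Δt (i₀ + j)) ω - θ + N (t' (i₀ + j)) ω) := by
    rw [← hc]
    ext ω
    simp [u, x, z, Finset.mul_sum, mul_assoc, mul_add]
  have hvpos : 0 < s2 - a ^ 2 * s2 + a ^ 2 * (q * σn ^ 2 / (q + σn ^ 2)) := by
    have h1 : 0 < a ^ 2 * (q * σn ^ 2 / (q + σn ^ 2)) := by
      have : 0 < a := Real.exp_pos _
      positivity
    nlinarith
  refine ⟨q, hq, fun h ↦ hq' (by omega), ?_⟩
  refine hX.mutualInfo_eq hκ hσ hN (fun j : Fin (k + 1) ↦ uniformTime Δt (i₀ + j))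
    (fun j ↦ i₀ + j) t (fun j ↦ a * c j) hvpos (fun j ↦ ?_) ?_
  · rw [← hup]
    exact hpred.1 _ ⟨j, rfl⟩
  · rw [← hup, ← covariance_self (u - a • p).2.aemeasurable]
    exact hpred.2

end ValueOfInformation

theorem corollary2 (κ : ℝ) (hκ : 0 < κ) (Δt : ℝ≥0) (hΔt : 0 < Δt) (τ : ℝ) (hτ : 0 < τ) :
    ∃ γ₀ C : ℝ, 0 < γ₀ ∧ 0 ≤ C ∧
      ∀ (θ σ σn : ℝ), 0 < σ → 0 < σn → γ₀ ≤ snr κ σ σn →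
      ∀ (Ω : Type*) [MeasurableSpace Ω] (P : Measure Ω) [IsProbabilityMeasure P]
        (X W N : ℝ≥0 → Ω → ℝ) (t' : ℕ → ℝ≥0),
        IsOUProcess κ θ σ X W P →
        (∀ i, uniformTime Δt i < t' i) →
        IsChannelNoise σn t' X N P →
      ∀ (m n : ℕ) (t : ℝ≥0), 2 ≤ m → m ≤ n → t' n < t → (t : ℝ) - uniformTime Δt n = τ →
        valueOfInformation (uniformTime Δt) t' X N P m n t ≠ ∞ ∧
        |(valueOfInformation (uniformTime Δt) t' X N P m n t).toReal -
            (markovTerm κ τ - highSNRCorrection κ τ (Real.exp (-κ * Δt)) (snr κ σ σn))|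
          ≤ C / snr κ σ σn ^ 3 := by
  have hρ : Real.exp (-κ * Δt) ^ 2 < 1 := exp_neg_mul_sq_lt_one hκ hΔt
  set ρ := Real.exp (-κ * Δt) with hρdef
  have hd : 0 < 1 - ρ ^ 2 := by linarith
  have hE : 0 < Real.exp (2 * κ * τ) - 1 := sub_pos.2 (Real.one_lt_exp_iff.2 (by positivity))
  -- The threshold means `1 / γ ≤ 1 - ρ²`, which keeps the argument of the approximating logarithm
  -- at least `1`.
  refine ⟨1 / (1 - ρ ^ 2), 1 / (Real.exp (2 * κ * τ) - 1) / (1 - ρ ^ 2) ^ 2, by positivity,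
    by positivity, ?_⟩
  intro θ σ σn hσ hσn hγ Ω _ P _ X W N t' hX htt' hN m n t hm hmn ht hτt
  obtain ⟨q, hq, hq', hfin, hval⟩ := hX.exists_valueOfInformation_eq hκ hσ hσn hN hΔt
    (by omega : 1 ≤ m) hmn ((htt' n).trans ht).le
  refine ⟨hfin, ?_⟩
  rw [hτt, ← hρdef] at *
  have hs2 : 0 < σ ^ 2 / (2 * κ) := by positivity
  have hr : 0 < σn ^ 2 := by positivity
  have hγ' : 1 / snr κ σ σn = σn ^ 2 / (σ ^ 2 / (2 * κ)) := by rw [snr, one_div_div]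
  have hq0 : 0 < q := lt_of_lt_of_le (mul_pos hd hs2) hq
  -- Dividing all variances by `σ² / (2κ)` turns the noise variance into `1 / γ`.
  convert abs_log_sub_highSNR_le (q := q / (σ ^ 2 / (2 * κ))) hκ hτ hρ hγ ?_ ?_ using 4
  · rw [hval, hγ']
    set s2 := σ ^ 2 / (2 * κ)
    congr 2
    field_simp
  · rwa [le_div_iff₀ hs2]
  · rw [hγ', div_le_iff₀ hs2, add_mul, mul_assoc, div_mul_cancel₀ _ hs2.ne']
    exact hq' hm
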